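/- Let $p$ be a prime, let $K$ be an algebraically closed field of characteristic $p$, and let $G=\langle\sigma\rangle$ be a cyclic group of order $p$. Let $V$ be a finite-dimensional representation of $G$ over $K$ that is a direct sum $V=\bigoplus_{j=1}^{l}V_{n_j}$ of $l\ge 1$ indecomposable modules, none of them trivial; here $V_n$ denotes the $n$-dimensional module on which $\sigma$ acts by a single Jordan block with eigenvalue $1$, and $n_j>1$ for all $j$. The group $G$ acts on $K[V]=S(V^*)$ by $g(f)=f\circ g^{-1}$. Let $(x_{i,j})_{1\le i\le n_j,\,1\le j\le l}$ be a basis of $V^*$ with $\sigma(x_{1,j})=x_{1,j}$ and $\sigma(x_{i,j})=x_{i,j}+x_{i-1,j}$ for $1<i\le n_j$, so that $K[V]=K[x_{i,j}]$. For $f\in K[V]$ let $N(f)=\prod_{g\in G}g(f)$ be its norm. Let $K[V]^G$ be the graded ring of invariants and let $I^G\subseteq K[V]^G$ be the transfer ideal, that is, the image of the transfer map $K[V]\to K[V]^G$, $f\mapsto\sum_{g\in G}g(f)$. For a graded $K$-algebra $R$ and a graded $R$-module $M$, $\operatorname{depth}(M)$ denotes the maximal length of an $M$-regular sequence of homogeneous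 elements of $R_+=\bigoplus_{d\ge 1}R_d$. A finitely generated nonzero graded $M$ is Cohen–Macaulay if $\operatorname{depth}(M)=\dim (R/\operatorname{Ann}_R M)$, and $R$ is Cohen–Macaulay if it is so as a module over itself. A homogeneous system of parameters (hsop) of $R$ is a family of homogeneous elements $a_1,\dots,a_m$ of $R$, algebraically independent over $K$, such that $R$ is a finitely generated module over $K[a_1,\dots,a_m]$. Then: 1. the graded algebra $K[V]^G/I^G$ is Cohen–Macaulay; 2. the elements $N(x_{n_j,j})+I^G$, $1\le j\le l$, form an hsop of $K[V]^G/I^G$; 3. the ideal $I^G$, regarded as a $K[V]^G$-module, has $\operatorname{depth}(I^G)=l+1$. -/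

import Mathlib

noncomputable section

namespace ModularTransfer

/-! ### Grade, depth, Cohen-Macaulay modules and hsops over a graded algebra

In this section `R` is a commutative `K`-algebra with a grading `R = ⨁ d, 𝒜 d`, given by its
homogeneous components `𝒜 : ℕ → Submodule K R`. -/

/-- The ideal `R₊` generated by the homogeneous elements of positive degree. -/
def irrelevantIdeal {K R : Type*} [CommRing K] [CommRing R] [Algebra K R]
    (𝒜 : ℕ → Submodule K R) : Ideal R :=
  Ideal.span {a : R | ∃ d : ℕ, 0 < d ∧ a ∈ 𝒜 d}

/-- `as = [a₁, …, aₖ]` is an `M`-regular sequence of homogeneous elements lying in `I`: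
each `aᵢ` is a nonzerodivisor on `M / (a₁, …, aᵢ₋₁) M`. -/
def IsHomogeneousRegularSeq {K R : Type*} [CommRing K] [CommRing R] [Algebra K R]
    (𝒜 : ℕ → Submodule K R) (I : Ideal R) (M : Type*) [AddCommGroup M] [Module R M]
    (as : List R) : Prop :=
  (∀ a ∈ as, a ∈ I ∧ ∃ d : ℕ, a ∈ 𝒜 d) ∧ RingTheory.Sequence.IsWeaklyRegular M as

/-- The grade of `I` on `M`: the maximal length (in `ℕ∞`) of an `M`-regular sequence of
homogeneous elements lying in `I`. -/
def grade {K R : Type*} [CommRing K] [CommRing R] [Algebra K R]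
    (𝒜 : ℕ → Submodule K R) (I : Ideal R) (M : Type*) [AddCommGroup M] [Module R M] : ℕ∞ :=
  ⨆ as ∈ {as : List R | IsHomogeneousRegularSeq 𝒜 I M as}, (as.length : ℕ∞)

/-- The depth of `M` is the grade of `R₊` on `M`. -/
def depth {K R : Type*} [CommRing K] [CommRing R] [Algebra K R]
    (𝒜 : ℕ → Submodule K R) (M : Type*) [AddCommGroup M] [Module R M] : ℕ∞ :=
  grade 𝒜 (irrelevantIdeal 𝒜) M

/-- The Krull dimension `dim (R / Ann M)` of `M`. -/
def moduleDim (R M : Type*) [CommRing R] [AddCommGroup M] [Module R M] : WithBot ℕ∞ :=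
  ringKrullDim (R ⧸ Module.annihilator R M)

/-- A finitely generated nonzero graded module is Cohen-Macaulay if its depth equals its
dimension. -/
def IsCohenMacaulay {K R : Type*} [CommRing K] [CommRing R] [Algebra K R]
    (𝒜 : ℕ → Submodule K R) (M : Type*) [AddCommGroup M] [Module R M] : Prop :=
  Module.Finite R M ∧ Nontrivial M ∧ (depth 𝒜 M : WithBot ℕ∞) = moduleDim R M

/-- `a` is a homogeneous system of parameters of `R`: its members are homogeneous and
algebraically independent over `K`, and `R` is a finitely generated module over the
subalgebra `K[a]`. -/
def IsHsop {K R ι : Type*} [CommRing K] [CommRing R] [Algebra K R]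
    (𝒜 : ℕ → Submodule K R) (a : ι → R) : Prop :=
  (∀ i, ∃ d : ℕ, a i ∈ 𝒜 d) ∧ AlgebraicIndependent K a ∧
    Module.Finite (Algebra.adjoin K (Set.range a)) R

/-- The grading induced on the quotient of a graded algebra by a homogeneous ideal. -/
def quotientGrading {K R : Type*} [CommRing K] [CommRing R] [Algebra K R]
    (𝒜 : ℕ → Submodule K R) (I : Ideal R) (d : ℕ) : Submodule K (R ⧸ I) :=
  (𝒜 d).map (Ideal.Quotient.mkₐ K I).toLinearMap

/-! ### Polynomial functions, invariants, norm and transfer -/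

/-- `K[V] = S(V*)`. -/
def PolyRing (K V : Type*) [Field K] [AddCommGroup V] [Module K V] : Type _ :=
  SymmetricAlgebra K (Module.Dual K V)

instance instCommRingPolyRing (K V : Type*) [Field K] [AddCommGroup V] [Module K V] :
    CommRing (PolyRing K V) :=
  inferInstanceAs (CommRing (SymmetricAlgebra K (Module.Dual K V)))

instance instAlgebraPolyRing (K V : Type*) [Field K] [AddCommGroup V] [Module K V] :
    Algebra K (PolyRing K V) :=
  inferInstanceAs (Algebra K (SymmetricAlgebra K (Module.Dual K V)))

/-- The inclusion `V* → K[V]` of the linear forms. -/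
def linearForm (K V : Type*) [Field K] [AddCommGroup V] [Module K V] :
    Module.Dual K V →ₗ[K] PolyRing K V :=
  SymmetricAlgebra.ι K (Module.Dual K V)

/-- The algebra homomorphism `K[V] → A` that extends a linear map `V* → A`. -/
def liftPoly {K V A : Type*} [Field K] [AddCommGroup V] [Module K V] [CommRing A] [Algebra K A]
    (f : Module.Dual K V →ₗ[K] A) : PolyRing K V →ₐ[K] A :=
  SymmetricAlgebra.lift f

theorem liftPoly_linearForm {K V A : Type*} [Field K] [AddCommGroup V] [Module K V]
    [CommRing A] [Algebra K A] (f : Module.Dual K V →ₗ[K] A) (v : Module.Dual K V) :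
    liftPoly f (linearForm K V v) = f v :=
  SymmetricAlgebra.lift_ι_apply f v

theorem polyRing_algHom_ext {K V A : Type*} [Field K] [AddCommGroup V] [Module K V]
    [CommRing A] [Algebra K A] {F₁ F₂ : PolyRing K V →ₐ[K] A}
    (h : ∀ v, F₁ (linearForm K V v) = F₂ (linearForm K V v)) : F₁ = F₂ :=
  SymmetricAlgebra.algHom_ext (LinearMap.ext h)

/-- The homogeneous polynomials of degree `d`: the span of the products of `d` linear forms. -/
def polyGrading (K V : Type*) [Field K] [AddCommGroup V] [Module K V] (d : ℕ) :
    Submodule K (PolyRing K V) :=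
  LinearMap.range (linearForm K V) ^ d

/-- The action of `g` on `K[V]`: the algebra endomorphism that extends the action
`f ↦ f ∘ g⁻¹` on `V*`. -/
def act {K G V : Type*} [Field K] [Group G] [AddCommGroup V] [Module K V]
    (ρ : Representation K G V) (g : G) : PolyRing K V →ₐ[K] PolyRing K V :=
  liftPoly (linearForm K V ∘ₗ ρ.dual g)

theorem act_mul {K G V : Type*} [Field K] [Group G] [AddCommGroup V] [Module K V]
    (ρ : Representation K G V) (g h : G) (f : PolyRing K V) :
    act ρ (g * h) f = act ρ g (act ρ h f) := by
  have : act ρ (g * h) = (act ρ g).comp (act ρ h) := by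
    refine polyRing_algHom_ext fun v => ?_
    rw [AlgHom.comp_apply]
    simp only [act, liftPoly_linearForm, LinearMap.comp_apply, map_mul, Module.End.mul_apply]
  rw [this, AlgHom.comp_apply]

/-- The invariant ring `K[V]^G`. -/
def invariantRing {K G V : Type*} [Field K] [Group G] [AddCommGroup V] [Module K V]
    (ρ : Representation K G V) : Subalgebra K (PolyRing K V) where
  carrier := {f | ∀ g : G, act ρ g f = f}
  mul_mem' ha hb g := by rw [map_mul, ha g, hb g]
  add_mem' ha hb g := by rw [map_add, ha g, hb g]
  algebraMap_mem' r g := AlgHom.commutes _ r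

/-- The grading of `K[V]^G` by the degree of polynomials. -/
def invariantGrading {K G V : Type*} [Field K] [Group G] [AddCommGroup V] [Module K V]
    (ρ : Representation K G V) (d : ℕ) : Submodule K (invariantRing ρ) :=
  (polyGrading K V d).comap (invariantRing ρ).val.toLinearMap

/-- The norm `N(f) = ∏ g, g f`. -/
def norm {K G V : Type*} [Field K] [Group G] [Fintype G] [AddCommGroup V] [Module K V]
    (ρ : Representation K G V) (f : PolyRing K V) : invariantRing ρ :=
  ⟨∏ g : G, act ρ g f, fun h => by
    rw [map_prod]
    simp only [← act_mul]
    exact Fintype.prod_equiv (Equiv.mulLeft h) _ _ fun _ => rfl⟩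

/-- The transfer `f ↦ ∑ g, g f`, as a `K[V]^G`-linear map `K[V] → K[V]^G`. -/
def transfer {K G V : Type*} [Field K] [Group G] [Fintype G] [AddCommGroup V] [Module K V]
    (ρ : Representation K G V) : PolyRing K V →ₗ[invariantRing ρ] invariantRing ρ where
  toFun f := ⟨∑ g : G, act ρ g f, fun h => by
    rw [map_sum]
    simp only [← act_mul]
    exact Fintype.sum_equiv (Equiv.mulLeft h) _ _ fun _ => rfl⟩
  map_add' f₁ f₂ := by
    apply Subtype.ext
    simp [Finset.sum_add_distrib]
  map_smul' r f := by
    apply Subtype.ext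
    simp only [Subalgebra.smul_def, smul_eq_mul, map_mul, RingHom.id_apply,
      MulMemClass.coe_mul, Finset.mul_sum]
    exact Finset.sum_congr rfl fun g _ => by rw [r.2 g]

/-- The transfer ideal `I^G` of `K[V]^G`: the image of the transfer. -/
def transferIdeal {K G V : Type*} [Field K] [Group G] [Fintype G] [AddCommGroup V] [Module K V]
    (ρ : Representation K G V) : Ideal (invariantRing ρ) :=
  LinearMap.range (transfer ρ)

instance instModuleIdeal {K G V : Type*} [Field K] [Group G] [AddCommGroup V] [Module K V]
    (ρ : Representation K G V) (I : Ideal (invariantRing ρ)) : Module (invariantRing ρ) I :=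
  Submodule.module I

/-- `σ` acts on the coordinate functions `x_{i,j}` (`j : Fin l`, `i : Fin (n j)`, with `i`
counted from `0`) in Jordan form: it fixes `x_{0,j}` and maps `x_{i+1,j}` to
`x_{i+1,j} + x_{i,j}`. Thus `V` is the direct sum of Jordan blocks `V_{n j}`. -/
def IsJordanBasis {K G V : Type*} [Field K] [Group G] [AddCommGroup V] [Module K V]
    (ρ : Representation K G V) (σ : G) {l : ℕ} {n : Fin l → ℕ}
    (x : Module.Basis (Σ j : Fin l, Fin (n j)) K (Module.Dual K V)) : Prop :=
  (∀ (j : Fin l) (i : Fin (n j)), (i : ℕ) = 0 → ρ.dual σ (x ⟨j, i⟩) = x ⟨j, i⟩) ∧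
  (∀ (j : Fin l) (i i' : Fin (n j)), (i' : ℕ) = (i : ℕ) + 1 →
    ρ.dual σ (x ⟨j, i'⟩) = x ⟨j, i'⟩ + x ⟨j, i⟩)

/-- The last variable `x_{n_j,j}` of the `j`-th block, as an element of `K[V]`. -/
def lastVariable {K V : Type*} [Field K] [AddCommGroup V] [Module K V]
    {l : ℕ} {n : Fin l → ℕ} (hn : ∀ j, 1 < n j)
    (x : Module.Basis (Σ j : Fin l, Fin (n j)) K (Module.Dual K V)) (j : Fin l) :
    PolyRing K V :=
  linearForm K V
    (x ⟨j, ⟨n j - 1, Nat.sub_lt (Nat.lt_trans Nat.zero_lt_one (hn j)) Nat.zero_lt_one⟩⟩)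

end ModularTransfer

end

universe u

/-! Write `R = K[V]^G`, `I = I^G`, `y_j` for the last variable of block `j` and `N_j = N(y_j)`.

Division. As a polynomial in `y_j`, the norm `N_j` is monic, while `N_i` for `i ≠ j` and all first
variables are free of `y_j`. Let `Q_j` be the quotient operator of division by `N_j` with respect to
`y_j`. Each `g` translates `y_j` by a form free of `y_j` and fixes `N_j`, so `Q_j` commutes with `G`
(`quotLast_act`). Hence `Q_j` preserves `R` and `I`, is a left inverse of multiplication by `N_j`,
and commutes with the other norms and the first variables. Such operators descend to quotients, so
the norms are regular on `R/I`, and a first variable followed by the norms is regular on `I`.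

Fixed points. Restriction to `V^G` sends `K[V]` onto `K[y_1, …, y_l]`, kills `I` because `|G| = 0`
in `K`, and sends `N_j` to `y_j^p`. Conversely, `(σ - 1)a` is nilpotent modulo `I K[V]`, so an
invariant restricting to zero lies in the radical of `I`. Thus the `p`-th power of every invariant
is a polynomial in the norms modulo that radical (`pow_sub_normPolynomial_mem_radical`). The norms
therefore form an hsop of `R/I`, which has dimension `l`.

Maximality. Some `s` outside `I + (N)` is killed by `R_+` modulo `I + (N)`. Through vanishing of
Ext, such a socle element bounds the length of every regular sequence on `R/I` by `l`. With `P` the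
simultaneous remainder modulo all norms and `x` a first variable, `x P(s)` is a socle element of `I
/ (x, N) I` (`exists_socle_ideal`), which gives depth `l + 1` for `I`. -/

namespace ModularTransfer

/-! ### Bounding regular sequences through Ext -/

open CategoryTheory CategoryTheory.Abelian RingTheory.Sequence Pointwise in
/-- If `Ext i N M` vanishes for `i ≤ r` and `as` is a weakly `M`-regular sequence of length `r`,
then `Hom(N, M / (as) M)` vanishes. -/
theorem subsingleton_linearMap_of_subsingleton_ext {R : Type u} [CommRing R]
    (N M : ModuleCat R) (as : List R) (has : IsWeaklyRegular M as)
    (h : ∀ i ≤ as.length, Subsingleton (Ext N M i)) :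
    Subsingleton (N →ₗ[R] M ⧸ (Ideal.ofList as • ⊤ : Submodule R M)) := by
  induction as generalizing M with
  | nil =>
    have h0 := h 0 le_rfl
    have : Subsingleton (N →ₗ[R] M) :=
      (Ext.addEquiv₀.trans ModuleCat.homAddEquiv).symm.subsingleton
    let e : (M ⧸ (Ideal.ofList ([] : List R) • ⊤ : Submodule R M)) ≃ₗ[R] M :=
      Submodule.quotEquivOfEqBot _ (by simp)
    exact (LinearEquiv.congrRight e).toEquiv.subsingleton
  | cons a as ih =>
    rw [isWeaklyRegular_cons_iff] at has
    have key := ih (ModuleCat.of R (QuotSMulTop a M)) has.2 (by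
      -- In the long exact sequence of `0 → M → M → M/aM → 0`, `Ext i N (M/aM)` sits between `Ext i
      -- N M` and `Ext (i + 1) N M`.
      intro i hi
      have zero1 := AddCommGrpCat.isZero_of_iff_subsingleton.mpr
        (h i (by simp only [List.length_cons]; omega))
      have zero2 := AddCommGrpCat.isZero_of_iff_subsingleton.mpr
        (h (i + 1) (by simp only [List.length_cons]; omega))
      exact AddCommGrpCat.subsingleton_of_isZero <| ShortComplex.Exact.isZero_of_both_zeros
        ((Ext.covariant_sequence_exact₃' N has.1.smulShortComplex_shortExact) i (i + 1) rfl)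
        (zero1.eq_zero_of_src _) (zero2.eq_zero_of_tgt _))
    exact (LinearEquiv.congrRight
      (Submodule.quotOfListConsSMulTopEquivQuotSMulTopInner M a as)).toEquiv.subsingleton

open CategoryTheory CategoryTheory.Abelian RingTheory.Sequence in
/-- A weakly regular sequence whose quotient has a nonzero element killed by `J` has
maximal length among all weakly regular sequences in `J`. -/
theorem length_le_of_isWeaklyRegular {R M : Type u} [CommRing R] [IsNoetherianRing R]
    [AddCommGroup M] [Module R M] [Module.Finite R M] (J : Ideal R) {as bs : List R}
    (has : IsWeaklyRegular M as)
    (hbs : IsWeaklyRegular M bs) (hbs_mem : ∀ b ∈ bs, b ∈ J)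
    {u : M} (hu : u ∉ (Ideal.ofList as • ⊤ : Submodule R M))
    (hJu : ∀ c ∈ J, c • u ∈ (Ideal.ofList as • ⊤ : Submodule R M)) :
    bs.length ≤ as.length := by
  -- Nakayama: if `J M = M`, some `r` with `r - 1 ∈ J` kills `M`, so `u = -(r - 1) u` would lie in
  -- `(as) M`.
  have hlt : J • (⊤ : Submodule R M) < ⊤ := by
    refine lt_top_iff_ne_top.mpr fun htop => hu ?_
    obtain ⟨r, hr, hr0⟩ := Submodule.exists_sub_one_mem_and_smul_eq_zero_of_fg_of_le_smul J
      (⊤ : Submodule R M) Module.Finite.fg_top htop.ge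
    have h1 : u = -((r - 1) • u) := by rw [sub_smul, hr0 u trivial, one_smul]; simp
    rw [h1]
    exact Submodule.neg_mem _ (hJu _ hr)
  have hreg : IsRegular M bs := ⟨hbs, fun h => hlt.ne <| top_le_iff.mp <|
    h.le.trans (Submodule.smul_mono_left (Ideal.span_le.mpr hbs_mem))⟩
  by_contra! hlen
  have hvanish := ModuleCat.subsingleton_ext_of_exists_isRegular J (ModuleCat.of R (R ⧸ J))
    (by rw [Module.support_eq_zeroLocus, Ideal.annihilator_quotient])
    (ModuleCat.of R M) hlt bs hbs_mem hreg
  have hsub := subsingleton_linearMap_of_subsingleton_ext (ModuleCat.of R (R ⧸ J))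
    (ModuleCat.of R M) as has fun i hi => hvanish i (hi.trans_lt hlen)
  -- The map `1 ↦ u` is well defined and nonzero, contradicting the vanishing of `Hom(R/J, M/(as)M)`
  -- forced by a longer sequence `bs`.
  let f : (R ⧸ J) →ₗ[R] M ⧸ (Ideal.ofList as • ⊤ : Submodule R M) :=
    Submodule.liftQ J (LinearMap.toSpanSingleton R _ (Submodule.Quotient.mk u)) fun c hc => by
      rw [LinearMap.mem_ker, LinearMap.toSpanSingleton_apply, ← Submodule.Quotient.mk_smul,
        Submodule.Quotient.mk_eq_zero]
      exact hJu c hc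
  have hf : f (Submodule.Quotient.mk 1) = Submodule.Quotient.mk u :=
    (Submodule.liftQ_apply J _ (1 : R)).trans
      (one_smul R (Submodule.Quotient.mk u : M ⧸ (Ideal.ofList as • ⊤ : Submodule R M)))
  have hf0 : f = 0 := hsub.elim f 0
  exact hu ((Submodule.Quotient.mk_eq_zero _).mp (by rw [← hf, hf0]; rfl))

/-! ### Dimension of integral extensions -/

/-- Krull dimension is preserved by injective integral extensions. -/
theorem ringKrullDim_eq_of_isIntegral {R S : Type*} [CommRing R] [CommRing S] [Algebra R S]
    [Algebra.IsIntegral R S] (hinj : Function.Injective (algebraMap R S)) :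
    ringKrullDim S = ringKrullDim R := by
  have : FaithfulSMul R S := (faithfulSMul_iff_algebraMap_injective R S).mpr hinj
  apply le_antisymm
  -- Incomparability makes contraction of primes strictly monotone. The other inequality is lying
  -- over for the smallest prime of a chain, then going up.
  · refine Order.krullDim_le_of_strictMono (PrimeSpectrum.comap (algebraMap R S)) ?_
    intro P Q hPQ
    exact Ideal.IsIntegral.comap_lt_comap (R := R) (I := P.asIdeal) (J := Q.asIdeal) hPQ
  · refine iSup_le fun c => ?_
    obtain ⟨P, hP, hPc⟩ := Ideal.exists_ideal_over_prime_of_isIntegral (S := S)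
      c.head.asIdeal ⊥ (by
        rw [← RingHom.ker_eq_comap_bot, (RingHom.injective_iff_ker_eq_bot _).mp hinj]
        exact bot_le)
    have : P.IsPrime := hPc.1
    have : P.LiesOver (RelSeries.head c).asIdeal := ⟨hPc.2.symm⟩
    obtain ⟨L, hL, -⟩ := Ideal.exists_ltSeries_of_hasGoingUp c P
    rw [← hL]
    exact Order.LTSeries.length_le_krullDim L

/-! ### Regular sequences from division operators -/

/-- An additive map that commutes with the generators of an ideal `J` preserves `J M`. -/
theorem map_mem_span_smul_top {R M : Type*} [CommRing R] [AddCommGroup M] [Module R M]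
    {s : Set R} (Q : M →+ M) (hQ : ∀ r ∈ s, ∀ m, Q (r • m) = r • Q m) {m : M}
    (hm : m ∈ (Ideal.span s • ⊤ : Submodule R M)) :
    Q m ∈ (Ideal.span s • ⊤ : Submodule R M) := by
  refine Submodule.smul_induction_on hm (fun r hr n _ => ?_) fun a b ha hb => ?_
  · refine Submodule.span_induction (p := fun r _ => ∀ n, Q (r • n) ∈
      (Ideal.span s • ⊤ : Submodule R M)) (fun r hr n => ?_) (fun n => ?_)
      (fun a b _ _ ha hb n => ?_) (fun c r _ hr n => ?_) hr n
    · rw [hQ r hr]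
      exact Submodule.smul_mem_smul (Ideal.subset_span hr) trivial
    · simp
    · rw [add_smul, map_add]
      exact add_mem (ha n) (hb n)
    · rw [smul_eq_mul, mul_comm, mul_smul]
      exact hr _
  · rw [map_add]
    exact add_mem ha hb

/-- If multiplication by `a` has an additive left inverse that commutes with the generators of
`J`, then `a` is regular on `M / J M`. -/
theorem isSMulRegular_quotient_of_leftInverse {R M : Type*} [CommRing R] [AddCommGroup M]
    [Module R M] {s : Set R} {a : R} (Q : M →+ M) (hQa : ∀ m, Q (a • m) = m)
    (hQ : ∀ r ∈ s, ∀ m, Q (r • m) = r • Q m) :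
    IsSMulRegular (M ⧸ (Ideal.span s • ⊤ : Submodule R M)) a := by
  rw [isSMulRegular_iff_right_eq_zero_of_smul]
  intro m
  induction m using Submodule.Quotient.induction_on with | _ m
  rw [← Submodule.Quotient.mk_smul, Submodule.Quotient.mk_eq_zero, Submodule.Quotient.mk_eq_zero]
  intro h
  simpa [hQa] using map_mem_span_smul_top Q hQ h

open RingTheory.Sequence in
theorem isWeaklyRegular_ofFn_of_leftInverse {R M : Type*} [CommRing R] [AddCommGroup M]
    [Module R M] {l : ℕ} (N : Fin l → R) (Q : Fin l → M →+ M) (hQ : ∀ j m, Q j (N j • m) = m)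
    (hQN : ∀ i j, i ≠ j → ∀ m, Q j (N i • m) = N i • Q j m) :
    IsWeaklyRegular M (List.ofFn N) := by
  refine ⟨fun i hi => ?_⟩
  have hil : i < l := by simpa using hi
  have := isSMulRegular_quotient_of_leftInverse (s := {r | r ∈ (List.ofFn N).take i})
    (Q ⟨i, hil⟩) (hQ _) (fun r hr m => by
      obtain ⟨k, hk, rfl⟩ := List.mem_take_iff_getElem.mp hr
      have hki : k < i := by omega
      simp only [List.getElem_ofFn]
      exact hQN _ _ (by simp [hki.ne]) m)
  simpa using this

open RingTheory.Sequence in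
-- Since `x` comes first, it only has to be regular on `M` itself and needs no left inverse; the
-- operators for the `N j` merely have to commute with it.
theorem isWeaklyRegular_cons_ofFn_of_leftInverse {R M : Type*} [CommRing R] [AddCommGroup M]
    [Module R M] {l : ℕ} {x : R} (hx : IsSMulRegular M x) (N : Fin l → R) (Q : Fin l → M →+ M)
    (hQ : ∀ j m, Q j (N j • m) = m) (hQN : ∀ i j, i ≠ j → ∀ m, Q j (N i • m) = N i • Q j m)
    (hQx : ∀ j m, Q j (x • m) = x • Q j m) :
    IsWeaklyRegular M (x :: List.ofFn N) := by
  refine ⟨fun i hi => ?_⟩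
  obtain _ | i := i
  · have e : (M ⧸ (Ideal.ofList ([] : List R) • ⊤ : Submodule R M)) ≃ₗ[R] M :=
      Submodule.quotEquivOfEqBot _ (by simp)
    exact (e.isSMulRegular_congr x).mpr hx
  have hil : i < l := by simpa using hi
  have := isSMulRegular_quotient_of_leftInverse (s := {r | r ∈ (x :: List.ofFn N).take (i + 1)})
    (Q ⟨i, hil⟩) (hQ _) (fun r hr m => by
      rw [List.take_succ_cons] at hr
      obtain rfl | hr := List.mem_cons.mp hr
      · exact hQx _ _
      obtain ⟨k, hk, rfl⟩ := List.mem_take_iff_getElem.mp hr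
      have hki : k < i := by omega
      simp only [List.getElem_ofFn]
      exact hQN _ _ (by simp [hki.ne]) m)
  simpa using this

/-! ### Socle elements -/

/-- If `J` has a power inside the proper ideal `L`, some element outside `L` is killed by `J`
modulo `L`. -/
theorem exists_notMem_forall_mul_mem {R : Type*} [CommRing R] [IsNoetherianRing R]
    {J L : Ideal R} (hL : L ≠ ⊤) (hJL : J ≤ L.radical) :
    ∃ s ∉ L, ∀ c ∈ J, c * s ∈ L := by
  classical
  obtain ⟨k, hk⟩ := L.exists_radical_pow_le_of_fg (IsNoetherian.noetherian _)
  -- For the least such exponent, which is positive as `L` is proper, any `s` in the preceding power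
  -- of `J` but outside `L` works.
  have hex : ∃ k, J ^ k ≤ L := ⟨k, (Ideal.pow_right_mono hJL k).trans hk⟩
  have h0 : Nat.find hex ≠ 0 := fun h => hL <| by
    have := Nat.find_spec hex
    rw [h, pow_zero, Ideal.one_eq_top] at this
    exact top_le_iff.mp this
  obtain ⟨m, hm⟩ := Nat.exists_eq_succ_of_ne_zero h0
  have hlt : ¬ J ^ m ≤ L := Nat.find_min hex (by omega)
  obtain ⟨s, hs, hsL⟩ := SetLike.not_le_iff_exists.mp hlt
  refine ⟨s, hsL, fun c hc => Nat.find_spec hex ?_⟩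
  rw [hm, pow_succ']
  exact Ideal.mul_mem_mul hc hs

/-- A simultaneous remainder operator `P` for division by all the `N j`, `j ∈ t`, together with
the quotient operators `C j`, obtained from division operators `Q j`. -/
theorem exists_remainder {A ι : Type*} [CommRing A] [DecidableEq ι] (I : Ideal A) (x : A)
    (N : ι → A) (Q : ι → A →+ A) (hQ : ∀ j a, Q j (N j * a) = a)
    (hQN : ∀ i j, i ≠ j → ∀ a, Q j (N i * a) = N i * Q j a)
    (hQx : ∀ j a, Q j (x * a) = x * Q j a) (hQI : ∀ j, ∀ a ∈ I, Q j a ∈ I) (t : Finset ι) :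
    ∃ (P : A →+ A) (C : ι → A →+ A), (∀ j ∈ t, ∀ a, P (N j * a) = 0) ∧
      (∀ j ∉ t, ∀ a, P (N j * a) = N j * P a) ∧ (∀ a, P (x * a) = x * P a) ∧
      (∀ a ∈ I, P a ∈ I) ∧ (∀ j, ∀ a ∈ I, C j a ∈ I) ∧
      ∀ a, a = P a + ∑ j ∈ t, N j * C j a := by
  induction t using Finset.induction_on with
  | empty =>
    exact ⟨AddMonoidHom.id A, fun _ => 0, by simp, by simp, by simp, by simp, by simp, by simp⟩
  | insert i t hi ih =>
    obtain ⟨P, C, h0, hN, hx, hPI, hCI, hsum⟩ := ih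
    let D : A →+ A := AddMonoidHom.id A - (AddMonoidHom.mulLeft (N i)).comp (Q i)
    have hD : ∀ a, D a = a - N i * Q i a := fun a => rfl
    -- `D` is the remainder modulo `N i`. Since `P` commutes with `N i` for `i ∉ t`, `P a = P (D a)
    -- + N i * P (Q i a)`, so the new quotient operator is `P ∘ Q i`.
    refine ⟨P.comp D, Function.update C i (P.comp (Q i)), ?_, ?_, ?_, ?_, ?_, ?_⟩
    · intro j hj a
      by_cases hji : j = i
      · subst hji
        simp [hD, hQ]
      · have hjt : j ∈ t := Finset.mem_of_mem_insert_of_ne hj hji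
        rw [AddMonoidHom.comp_apply, hD, hQN j i hji, mul_left_comm, ← mul_sub, h0 j hjt]
    · intro j hj a
      rw [Finset.mem_insert, not_or] at hj
      rw [AddMonoidHom.comp_apply, hD, hQN j i hj.1, mul_left_comm, ← mul_sub, hN j hj.2]
      rfl
    · intro a
      rw [AddMonoidHom.comp_apply, hD, hQx, mul_left_comm, ← mul_sub, hx]
      rfl
    · exact fun a ha => hPI _ (I.sub_mem ha (I.mul_mem_left _ (hQI i a ha)))
    · intro j a ha
      by_cases hji : j = i
      · subst hji
        simpa using hPI _ (hQI j a ha)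
      · simpa [hji] using hCI j a ha
    · intro a
      rw [Finset.sum_insert hi, Function.update_self, AddMonoidHom.comp_apply,
        AddMonoidHom.comp_apply, hD, map_sub, hN i hi]
      have : ∑ j ∈ t, N j * (Function.update C i (P.comp (Q i)) j) a = ∑ j ∈ t, N j * C j a :=
        Finset.sum_congr rfl fun j hj => by
          rw [Function.update_of_ne (ne_of_mem_of_not_mem hj hi)]
      rw [this]
      linear_combination hsum a

/-- The socle of `A / (I + (N))`, multiplied by `x`, gives the socle of `I / (x, N) I`. -/
theorem exists_socle_ideal {A : Type*} [CommRing A] [IsDomain A] {l : ℕ} (I J : Ideal A) {x : A}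
    (hx0 : x ≠ 0) (N : Fin l → A) (Q : Fin l → A →+ A) (hQ : ∀ j a, Q j (N j * a) = a)
    (hQN : ∀ i j, i ≠ j → ∀ a, Q j (N i * a) = N i * Q j a)
    (hQx : ∀ j a, Q j (x * a) = x * Q j a) (hQI : ∀ j, ∀ a ∈ I, Q j a ∈ I) (hxJ : x ∈ J)
    {s : A} (hs : s ∉ I ⊔ Ideal.span (Set.range N))
    (hJs : ∀ c ∈ J, c * s ∈ I ⊔ Ideal.span (Set.range N)) :
    ∃ u : I, u ∉ (Ideal.ofList (x :: List.ofFn N) • ⊤ : Submodule A I) ∧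
      ∀ c ∈ J, c • u ∈ (Ideal.ofList (x :: List.ofFn N) • ⊤ : Submodule A I) := by
  obtain ⟨P, C, h0, -, hx, hPI, hCI, hsum⟩ :=
    exists_remainder I x N Q hQ hQN hQx hQI Finset.univ
  have hPspan : ∀ a ∈ Ideal.span (Set.range N), P a = 0 := by
    intro a ha
    obtain ⟨c, rfl⟩ := Ideal.mem_span_range_iff_exists_fun.mp ha
    rw [map_sum]
    exact Finset.sum_eq_zero fun j hj => by rw [mul_comm, h0 j hj]
  have hPsup : ∀ a ∈ I ⊔ Ideal.span (Set.range N), P a ∈ I := by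
    intro a ha
    obtain ⟨b, hb, c, hc, rfl⟩ := Submodule.mem_sup.mp ha
    rw [map_add, hPspan c hc, add_zero]
    exact hPI b hb
  have hsubspan : ∀ a, a - P a ∈ Ideal.span (Set.range N) := fun a => by
    have : a - P a = ∑ j, C j a * N j := by
      simp_rw [mul_comm]
      linear_combination hsum a
    rw [this]
    exact Ideal.mem_span_range_iff_exists_fun.mpr ⟨_, rfl⟩
  have hPP : ∀ a, P (P a) = P a := fun a => by
    have := hPspan _ (hsubspan a)
    rw [map_sub, sub_eq_zero] at this
    exact this.symm
  have hPs : P s ∉ I := fun h => hs <| by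
    rw [← sub_add_cancel s (P s), add_comm]
    exact Submodule.add_mem_sup h (hsubspan s)
  have hxs : x * P s ∈ I := by
    rw [← hx]
    exact hPsup _ (hJs x hxJ)
  set L := Ideal.ofList (x :: List.ofFn N) with hL
  have hxL : x ∈ L := Ideal.subset_span (by simp)
  have hNL : ∀ j, N j ∈ L := fun j => Ideal.subset_span (by simp)
  refine ⟨⟨x * P s, hxs⟩, fun hmem => ?_, fun c hc => ?_⟩
  -- `P` kills `N j * I` and commutes with `x`, so it maps `(x, N) I` into `x I`. It fixes `x * P
  -- s`; cancelling `x` would put `P s` in `I`.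
  · have hclaim : ∀ v : I, v ∈ (L • ⊤ : Submodule A I) → ∃ w ∈ I, P v = x * w := by
      intro v hv
      refine Submodule.smul_induction_on hv (fun r hr n _ => ?_) ?_
      · refine Submodule.span_induction (p := fun r _ => ∀ n : I, ∃ w ∈ I,
          P ((r • n : I) : A) = x * w) (fun r hr n => ?_) (fun n => ⟨0, I.zero_mem, by simp⟩)
          (fun a b _ _ ha hb n => ?_) (fun c r _ hr n => ?_) hr n
        · obtain rfl | hr := List.mem_cons.mp hr
          · exact ⟨P n, hPI _ n.2, hx n⟩
          · obtain ⟨j, rfl⟩ := (List.mem_ofFn' _ _).mp hr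
            exact ⟨0, I.zero_mem, by simp [h0]⟩
        · obtain ⟨w, hw, hw'⟩ := ha n
          obtain ⟨z, hz, hz'⟩ := hb n
          exact ⟨w + z, I.add_mem hw hz, by rw [add_smul, Submodule.coe_add, map_add, hw', hz',
            mul_add]⟩
        · rw [smul_eq_mul, mul_comm, mul_smul]
          exact hr _
      · rintro a b ⟨w, hw, hw'⟩ ⟨z, hz, hz'⟩
        exact ⟨w + z, I.add_mem hw hz, by rw [Submodule.coe_add, map_add, hw', hz', mul_add]⟩
    obtain ⟨w, hw, hw'⟩ := hclaim _ hmem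
    rw [hx, hPP] at hw'
    exact hPs (mul_left_cancel₀ hx0 hw' ▸ hw)
  · have hcP : P (c * P s) ∈ I := by
      refine hPsup _ ?_
      rw [show c * P s = c * s - c * (s - P s) by ring]
      exact sub_mem (hJs c hc)
        (le_sup_right (a := I) (Ideal.mul_mem_left _ c (hsubspan s)))
    have hcI : c * (x * P s) ∈ I := I.mul_mem_left _ hxs
    -- Dividing `c x P(s)` by all the `N j` leaves the remainder `x P(c P(s))`. Here `P(c P(s))` and
    -- all the quotients lie in `I`, so each term is in `(x, N) I`.
    have hdecomp : c • (⟨x * P s, hxs⟩ : I) = x • (⟨P (c * P s), hcP⟩ : I) +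
        ∑ j, N j • (⟨C j (c * (x * P s)), hCI j _ hcI⟩ : I) := by
      apply Subtype.ext
      simp only [Submodule.coe_add, Submodule.coe_sum, Submodule.coe_smul, smul_eq_mul]
      rw [← hx (c * P s), mul_left_comm x c]
      exact hsum _
    rw [hdecomp]
    exact add_mem (Submodule.smul_mem_smul hxL trivial)
      (sum_mem fun j _ => Submodule.smul_mem_smul (hNL j) trivial)

/-! ### Invariants of a finite group and nilpotence modulo transfers -/

section Action

variable {K G V : Type*} [Field K] [Group G] [AddCommGroup V] [Module K V]

instance instIsDomainPolyRing (K V : Type*) [Field K] [AddCommGroup V] [Module K V] :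
    IsDomain (PolyRing K V) :=
  inferInstanceAs (IsDomain (SymmetricAlgebra K (Module.Dual K V)))

instance instFiniteTypePolyRing (K V : Type*) [Field K] [AddCommGroup V] [Module K V]
    [FiniteDimensional K V] : Algebra.FiniteType K (PolyRing K V) :=
  Algebra.FiniteType.equiv (inferInstance : Algebra.FiniteType K (MvPolynomial _ K))
    (SymmetricAlgebra.equivMvPolynomial (Module.finBasis K (Module.Dual K V))).symm

theorem linearForm_basis_ne_zero {ι : Type*} (x : Module.Basis ι K (Module.Dual K V)) (i : ι) :
    linearForm K V (x i) ≠ 0 := fun h => by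
  have := liftPoly_linearForm (x.coord i) (x i)
  rw [h, map_zero, x.coord_apply, x.repr_self, Finsupp.single_eq_same] at this
  exact zero_ne_one this

@[simp]
theorem act_linearForm (ρ : Representation K G V) (g : G) (v : Module.Dual K V) :
    act ρ g (linearForm K V v) = linearForm K V (ρ.dual g v) :=
  liftPoly_linearForm _ v

theorem act_one (ρ : Representation K G V) (f : PolyRing K V) : act ρ 1 f = f := by
  have : act ρ 1 = AlgHom.id K _ := polyRing_algHom_ext fun v => by
    rw [act_linearForm, map_one]
    rfl
  rw [this, AlgHom.id_apply]

/-- The action of `G` on `K[V]` by ring automorphisms. -/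
abbrev polyRingAction (ρ : Representation K G V) : MulSemiringAction G (PolyRing K V) where
  smul g f := act ρ g f
  one_smul := act_one ρ
  mul_smul := act_mul ρ
  smul_zero g := map_zero (act ρ g)
  smul_add g := map_add (act ρ g)
  smul_one g := map_one (act ρ g)
  smul_mul g := map_mul (act ρ g)

theorem isIntegral_invariantRing [Finite G] (ρ : Representation K G V) :
    Algebra.IsIntegral (invariantRing ρ) (PolyRing K V) := by
  let _ := polyRingAction ρ
  have : SMulCommClass G (invariantRing ρ) (PolyRing K V) := ⟨fun g a f => by
    change act ρ g (a * f) = a * act ρ g f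
    rw [map_mul, a.2 g]⟩
  have : Algebra.IsInvariant (invariantRing ρ) (PolyRing K V) G :=
    ⟨fun f hf => ⟨⟨f, hf⟩, rfl⟩⟩
  exact Algebra.IsInvariant.isIntegral (invariantRing ρ) (PolyRing K V) G

/-- Artin–Tate: `K[V]` is of finite type over `K` and module-finite over the invariants. -/
theorem finiteType_invariantRing [Finite G] [FiniteDimensional K V]
    (ρ : Representation K G V) : Algebra.FiniteType K (invariantRing ρ) := by
  have := isIntegral_invariantRing ρ
  have : Algebra.FiniteType (invariantRing ρ) (PolyRing K V) :=
    Algebra.FiniteType.of_restrictScalars_finiteType K _ _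
  have : Module.Finite (invariantRing ρ) (PolyRing K V) := Algebra.IsIntegral.finite
  exact ⟨fg_of_fg_of_fg K (invariantRing ρ) (PolyRing K V) Algebra.FiniteType.out
    Module.Finite.fg_top Subtype.val_injective⟩

theorem isNoetherianRing_invariantRing [Finite G] [FiniteDimensional K V]
    (ρ : Representation K G V) : IsNoetherianRing (invariantRing ρ) := by
  have := finiteType_invariantRing ρ
  exact Algebra.FiniteType.isNoetherianRing K _

variable [Fintype G]

@[simp]
theorem coe_transfer (ρ : Representation K G V) (f : PolyRing K V) :
    (transfer ρ f : PolyRing K V) = ∑ g, act ρ g f :=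
  rfl

@[simp]
theorem coe_norm (ρ : Representation K G V) (f : PolyRing K V) :
    (norm ρ f : PolyRing K V) = ∏ g, act ρ g f :=
  rfl

/-- Sum `∏_{g ≠ 1} (g a_g - h a_g)` over all `h`. For `h ≠ 1` the factor `g = h` vanishes, so only
the left side survives; expanding the products instead gives a `K[V]`-combination of transfers. -/
theorem prod_act_sub_mem_map_transferIdeal [DecidableEq G] (ρ : Representation K G V)
    (a : G → PolyRing K V) :
    ∏ g ∈ Finset.univ.erase 1, (act ρ g (a g) - a g) ∈
      (transferIdeal ρ).map (algebraMap (invariantRing ρ) (PolyRing K V)) := by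
  have hsum : ∏ g ∈ Finset.univ.erase 1, (act ρ g (a g) - a g) =
      ∑ h : G, ∏ g ∈ Finset.univ.erase 1, (act ρ g (a g) - act ρ h (a g)) := by
    rw [Finset.sum_eq_single 1]
    · simp_rw [act_one]
    · intro h _ hh
      exact Finset.prod_eq_zero (Finset.mem_erase.mpr ⟨hh, Finset.mem_univ h⟩) (sub_self _)
    · simp
  rw [hsum]
  simp_rw [sub_eq_add_neg, ← map_neg, Finset.prod_add]
  rw [Finset.sum_comm]
  refine sum_mem fun t _ => ?_
  simp_rw [← map_prod, ← Finset.mul_sum]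
  exact Ideal.mul_mem_left _ _ (Ideal.mem_map_of_mem _
    (LinearMap.mem_range_self (transfer ρ) (∏ i ∈ Finset.univ.erase 1 \ t, -a i)))

/-- In a group of prime order generated by `σ`, all `(σ - 1) a` are nilpotent modulo the ideal
generated by the transfers. -/
theorem act_sub_mem_radical_map_transferIdeal (ρ : Representation K G V)
    (hG : (Fintype.card G).Prime) (σ : G) (a : PolyRing K V) :
    act ρ σ a - a ∈
      ((transferIdeal ρ).map (algebraMap (invariantRing ρ) (PolyRing K V))).radical := by
  classical
  have hgen : ∀ g : G, g ≠ 1 → ∃ m : ℕ, g ^ m = σ := fun g hg => by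
    have : Fact (Nat.card G).Prime := ⟨by rwa [Nat.card_eq_fintype_card]⟩
    exact mem_powers_iff_mem_zpowers.mpr (mem_zpowers_of_prime_card rfl hg)
  choose m hm using hgen
  -- With `g ^ m = σ`, the sum `b g = a + g a + … + g^(m-1) a` telescopes to `g (b g) - b g = σ a -
  -- a`, so the product lemma yields a power of `σ a - a`.
  let b : G → PolyRing K V := fun g =>
    if hg : g = 1 then 0 else ∑ t ∈ Finset.range (m g hg), act ρ (g ^ t) a
  have hb : ∀ g ∈ (Finset.univ.erase 1 : Finset G), act ρ g (b g) - b g = act ρ σ a - a := by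
    intro g hg
    have hg1 : g ≠ 1 := (Finset.mem_erase.mp hg).1
    simp only [b, dif_neg hg1, map_sum, ← act_mul, ← pow_succ']
    rw [← Finset.sum_sub_distrib, Finset.sum_range_sub (fun t => act ρ (g ^ t) a), hm g hg1,
      pow_zero, act_one]
  have := prod_act_sub_mem_map_transferIdeal ρ b
  rw [Finset.prod_congr rfl hb, Finset.prod_const] at this
  exact ⟨_, this⟩

/-- An invariant that is nilpotent modulo the extension of an ideal of `K[V]^G` to `K[V]` is
nilpotent modulo that ideal. -/
theorem mem_radical_of_coe_mem_radical_map (ρ : Representation K G V)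
    {I : Ideal (invariantRing ρ)} {f : invariantRing ρ}
    (hf : (f : PolyRing K V) ∈
      (I.map (algebraMap (invariantRing ρ) (PolyRing K V))).radical) : f ∈ I.radical := by
  have := isIntegral_invariantRing ρ
  rw [Ideal.radical_eq_sInf, Ideal.mem_sInf]
  rintro P ⟨hIP, hP⟩
  obtain ⟨Q, -, hQ, rfl⟩ := Ideal.exists_ideal_over_prime_of_isIntegral (S := PolyRing K V) P ⊥
    (by
      intro a ha
      have ha0 : a = 0 := Subtype.ext (by simpa using ha)
      rw [ha0]
      exact P.zero_mem)
  have hle : I.map (algebraMap (invariantRing ρ) (PolyRing K V)) ≤ Q :=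
    Ideal.map_le_iff_le_comap.mpr hIP
  exact (hQ.radical_le_iff.mpr hle) hf

end Action

/-! ### Division by a monic polynomial -/

section DivByMonic

open Polynomial

variable {R : Type*} [CommRing R]

theorem add_divByMonic {q : R[X]} (hq : q.Monic) (f g : R[X]) :
    (f + g) /ₘ q = f /ₘ q + g /ₘ q := by
  nontriviality R
  refine (div_modByMonic_unique _ (f %ₘ q + g %ₘ q) hq ⟨?_, ?_⟩).1
  · linear_combination modByMonic_add_div f q + modByMonic_add_div g q
  · exact (degree_add_le _ _).trans_lt
      (max_lt (degree_modByMonic_lt f hq) (degree_modByMonic_lt g hq))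

theorem C_mul_divByMonic {q : R[X]} (hq : q.Monic) (a : R) (f : R[X]) :
    (C a * f) /ₘ q = C a * (f /ₘ q) := by
  nontriviality R
  refine (div_modByMonic_unique _ (C a * (f %ₘ q)) hq ⟨?_, ?_⟩).1
  · linear_combination C a * modByMonic_add_div f q
  · rw [← smul_eq_C_mul]
    exact (degree_smul_le _ _).trans_lt (degree_modByMonic_lt f hq)

/-- Division by a monic polynomial commutes with a substitution `Y ↦ Y + c` that follows a ring
homomorphism applied to the coefficients. -/
theorem map_comp_divByMonic {S : Type*} [CommRing S] {q : R[X]} (hq : q.Monic) (φ : R →+* S)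
    (c : S) (f : R[X]) :
    ((f /ₘ q).map φ).comp (X + C c) = (f.map φ).comp (X + C c) /ₘ (q.map φ).comp (X + C c) := by
  nontriviality S
  have hq' : ((q.map φ).comp (X + C c)).Monic := (hq.map φ).comp_X_add_C c
  refine (div_modByMonic_unique _ (((f %ₘ q).map φ).comp (X + C c)) hq' ⟨?_, ?_⟩).1.symm
  · rw [← mul_comp, ← add_comp, ← Polynomial.map_mul, ← Polynomial.map_add, modByMonic_add_div]
  -- Translation of the variable preserves degrees, so the transformed remainder still has degree
  -- below the divisor.
  · rw [← taylor_apply, ← taylor_apply, degree_taylor, degree_taylor, hq.degree_map φ]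
    have : Nontrivial R := φ.domain_nontrivial
    exact degree_map_le.trans_lt (degree_modByMonic_lt f hq)

end DivByMonic

/-! ### Jordan coordinates, restriction to fixed points, isolating a last variable -/

section Jordan

variable {K G V : Type*} [Field K] [Group G] [AddCommGroup V] [Module K V]
  {ρ : Representation K G V} {σ : G} {l : ℕ} {n : Fin l → ℕ} (hn : ∀ j, 1 < n j)
  (x : Module.Basis (Σ j : Fin l, Fin (n j)) K (Module.Dual K V))

/-- The index of the last variable of the `j`-th block. -/
def lastIndex {l : ℕ} {n : Fin l → ℕ} (hn : ∀ j, 1 < n j) (j : Fin l) : Σ j : Fin l, Fin (n j) :=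
  ⟨j, ⟨n j - 1, Nat.sub_lt (Nat.lt_trans Nat.zero_lt_one (hn j)) Nat.zero_lt_one⟩⟩

/-- The index of the first variable of the `j`-th block. -/
def firstIndex {l : ℕ} {n : Fin l → ℕ} (hn : ∀ j, 1 < n j) (j : Fin l) :
    Σ j : Fin l, Fin (n j) :=
  ⟨j, ⟨0, Nat.lt_trans Nat.zero_lt_one (hn j)⟩⟩

theorem lastVariable_eq (j : Fin l) :
    lastVariable hn x j = linearForm K V (x (lastIndex hn j)) :=
  rfl

/-- The span of the variables that precede `x s` in its block. -/
def lowerSpan (s : Σ j : Fin l, Fin (n j)) : Submodule K (Module.Dual K V) :=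
  Submodule.span K (x '' {t | t.1 = s.1 ∧ (t.2 : ℕ) < s.2})

theorem lowerSpan_mono {s t : Σ j : Fin l, Fin (n j)} (h1 : t.1 = s.1) (h2 : (t.2 : ℕ) ≤ s.2) :
    lowerSpan x t ≤ lowerSpan x s :=
  Submodule.span_mono (Set.image_mono fun _ hr => ⟨hr.1.trans h1, hr.2.trans_le h2⟩)

variable {x}

/-- `σ - 1` lowers the index within a block. The induction on the exponent runs over all `s` at
once, because it also gives stability of the lower span under `σ ^ k`. -/
theorem IsJordanBasis.dual_sub_mem_lowerSpan [Finite G] (hx : IsJordanBasis ρ σ x)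
    (hσ : ∀ g : G, g ∈ Subgroup.zpowers σ) (g : G) (s : Σ j : Fin l, Fin (n j)) :
    ρ.dual g (x s) - x s ∈ lowerSpan x s := by
  obtain ⟨k, rfl⟩ : ∃ k : ℕ, σ ^ k = g := mem_powers_iff_mem_zpowers.mpr (hσ g)
  induction k generalizing s with
  | zero =>
    rw [pow_zero, map_one, Module.End.one_apply, sub_self]
    exact zero_mem _
  | succ k ih =>
    have hpres : ∀ v ∈ lowerSpan x s, ρ.dual (σ ^ k) v ∈ lowerSpan x s := by
      intro v hv
      refine Submodule.span_induction ?_ ?_ ?_ ?_ hv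
      · rintro _ ⟨t, ht, rfl⟩
        rw [← sub_add_cancel (ρ.dual (σ ^ k) (x t)) (x t)]
        exact add_mem (lowerSpan_mono x ht.1 ht.2.le (ih t))
          (Submodule.subset_span ⟨t, ht, rfl⟩)
      · simp
      · intro a b _ _ ha hb
        rw [map_add]
        exact add_mem ha hb
      · intro c a _ ha
        rw [map_smul]
        exact Submodule.smul_mem _ _ ha
    have hstep : ρ.dual σ (x s) - x s ∈ lowerSpan x s := by
      obtain ⟨j, ⟨i, hi⟩⟩ := s
      obtain _ | i := i
      · rw [hx.1 j _ rfl, sub_self]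
        exact zero_mem _
      · rw [hx.2 j ⟨i, by omega⟩ ⟨i + 1, hi⟩ rfl, add_sub_cancel_left]
        exact Submodule.subset_span ⟨⟨j, ⟨i, by omega⟩⟩, ⟨rfl, Nat.lt_succ_self i⟩, rfl⟩
    have : ρ.dual (σ ^ (k + 1)) (x s) - x s =
        ρ.dual (σ ^ k) (ρ.dual σ (x s) - x s) + (ρ.dual (σ ^ k) (x s) - x s) := by
      rw [pow_succ, map_mul, Module.End.mul_apply, map_sub]
      abel
    rw [this]
    exact add_mem (hpres _ hstep) (ih s)

variable (x)

/-- Restriction of polynomial functions to `V^G`: the last variables become independent variables,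
all others are mapped to zero. -/
noncomputable def restrictFixed : PolyRing K V →ₐ[K] MvPolynomial (Fin l) K :=
  liftPoly (x.constr K fun s => if (s.2 : ℕ) + 1 = n s.1 then MvPolynomial.X s.1 else 0)

theorem restrictFixed_linearForm (s : Σ j : Fin l, Fin (n j)) :
    restrictFixed x (linearForm K V (x s)) =
      if (s.2 : ℕ) + 1 = n s.1 then MvPolynomial.X s.1 else 0 := by
  rw [restrictFixed, liftPoly_linearForm, Module.Basis.constr_basis]

theorem restrictFixed_lastVariable (j : Fin l) :
    restrictFixed x (lastVariable hn x j) = MvPolynomial.X j := by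
  rw [lastVariable_eq, restrictFixed_linearForm, if_pos]
  · rfl
  · have := hn j
    simp only [lastIndex]
    omega

theorem restrictFixed_of_mem_lowerSpan {s : Σ j : Fin l, Fin (n j)} {v : Module.Dual K V}
    (hv : v ∈ lowerSpan x s) : restrictFixed x (linearForm K V v) = 0 := by
  refine Submodule.span_induction ?_ ?_ ?_ ?_ hv
  · rintro _ ⟨⟨j, i⟩, ⟨ht1, ht2⟩, rfl⟩
    obtain ⟨j', i'⟩ := s
    obtain rfl : j = j' := ht1
    have := i'.2
    simp only at ht2
    rw [restrictFixed_linearForm, if_neg (by simp only; omega)]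
  · simp
  · intro a b _ _ ha hb
    rw [map_add, map_add, ha, hb, add_zero]
  · intro c a _ ha
    rw [map_smul, map_smul, ha, smul_zero]

/-- `g` changes each variable only by earlier ones of its block; none of these is last, so they
restrict to zero. -/
theorem IsJordanBasis.restrictFixed_act [Finite G]
    {x : Module.Basis (Σ j : Fin l, Fin (n j)) K (Module.Dual K V)} (hx : IsJordanBasis ρ σ x)
    (hσ : ∀ g : G, g ∈ Subgroup.zpowers σ) (g : G) (f : PolyRing K V) :
    restrictFixed x (act ρ g f) = restrictFixed x f := by
  have : (restrictFixed x).comp (act ρ g) = restrictFixed x := by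
    refine polyRing_algHom_ext fun v => ?_
    have : (restrictFixed x).toLinearMap ∘ₗ linearForm K V ∘ₗ ρ.dual g =
        (restrictFixed x).toLinearMap ∘ₗ linearForm K V := x.ext fun s => by
      have := restrictFixed_of_mem_lowerSpan x (hx.dual_sub_mem_lowerSpan hσ g s)
      rw [map_sub, map_sub, sub_eq_zero] at this
      exact this
    simpa using LinearMap.congr_fun this v
  exact DFunLike.congr_fun this f

/-- `K[V] → K[V][Y]`, substituting `Y` for the last variable of the `j`-th block. -/
noncomputable def splitLast (j : Fin l) : PolyRing K V →ₐ[K] Polynomial (PolyRing K V) := by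
  classical
  exact liftPoly (x.constr K fun s =>
    if s = lastIndex hn j then Polynomial.X else Polynomial.C (linearForm K V (x s)))

theorem splitLast_lastVariable (j : Fin l) :
    splitLast hn x j (lastVariable hn x j) = Polynomial.X := by
  rw [lastVariable_eq, splitLast, liftPoly_linearForm, Module.Basis.constr_basis, if_pos rfl]

theorem splitLast_basis {j : Fin l} {s : Σ j : Fin l, Fin (n j)} (hs : s ≠ lastIndex hn j) :
    splitLast hn x j (linearForm K V (x s)) = Polynomial.C (linearForm K V (x s)) := by
  rw [splitLast, liftPoly_linearForm, Module.Basis.constr_basis, if_neg hs]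

theorem splitLast_of_mem_lowerSpan {j : Fin l} {s : Σ j : Fin l, Fin (n j)} {v : Module.Dual K V}
    (hv : v ∈ lowerSpan x s) :
    splitLast hn x j (linearForm K V v) = Polynomial.C (linearForm K V v) := by
  refine Submodule.span_induction ?_ ?_ ?_ ?_ hv
  · rintro _ ⟨t, ⟨ht1, ht2⟩, rfl⟩
    refine splitLast_basis hn x ?_
    rintro rfl
    obtain ⟨j', i'⟩ := s
    obtain rfl : j = j' := ht1
    have := i'.2
    simp only [lastIndex] at ht2
    omega
  · simp
  · intro a b _ _ ha hb
    rw [map_add, map_add, ha, hb, map_add]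
  · intro c a _ ha
    rw [map_smul, map_smul, ha, Polynomial.smul_C]

theorem eval_splitLast (j : Fin l) (f : PolyRing K V) :
    (splitLast hn x j f).eval (lastVariable hn x j) = f := by
  have : ((Polynomial.aeval (R := PolyRing K V) (lastVariable hn x j)).restrictScalars K).comp
      (splitLast hn x j) =
      AlgHom.id K _ := by
    refine polyRing_algHom_ext fun v => ?_
    have : (((Polynomial.aeval (R := PolyRing K V) (lastVariable hn x j)).restrictScalars K).comp
        (splitLast hn x j)).toLinearMap ∘ₗ linearForm K V = linearForm K V := x.ext fun s => by
      by_cases hs : s = lastIndex hn j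
      · subst hs
        simp [← lastVariable_eq, splitLast_lastVariable]
      · simp [splitLast_basis hn x hs]
    exact LinearMap.congr_fun this v
  simpa [Polynomial.coe_aeval_eq_eval] using DFunLike.congr_fun this f

end Jordan
-- Equivariant division by the norms
section Division

variable {K G V : Type*} [Field K] [Group G] [AddCommGroup V] [Module K V]
  {ρ : Representation K G V} {σ : G} {l : ℕ} {n : Fin l → ℕ} (hn : ∀ j, 1 < n j)
  {x : Module.Basis (Σ j : Fin l, Fin (n j)) K (Module.Dual K V)}

/-- The difference `g y - y` for the last variable `y` of the `j`-th block. -/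
noncomputable def lastShift (ρ : Representation K G V)
    (x : Module.Basis (Σ j : Fin l, Fin (n j)) K (Module.Dual K V)) (j : Fin l) (g : G) :
    PolyRing K V :=
  linearForm K V (ρ.dual g (x (lastIndex hn j)) - x (lastIndex hn j))

theorem act_lastVariable (j : Fin l) (g : G) :
    act ρ g (lastVariable hn x j) = lastVariable hn x j + lastShift hn ρ x j g := by
  rw [lastShift, lastVariable_eq, act_linearForm, map_sub, add_sub_cancel]

variable [Fintype G]

theorem IsJordanBasis.splitLast_lastShift (hx : IsJordanBasis ρ σ x)
    (hσ : ∀ g : G, g ∈ Subgroup.zpowers σ) (i j : Fin l) (g : G) :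
    splitLast hn x j (lastShift hn ρ x i g) = Polynomial.C (lastShift hn ρ x i g) :=
  splitLast_of_mem_lowerSpan hn x (hx.dual_sub_mem_lowerSpan hσ g _)

theorem IsJordanBasis.monic_splitLast_norm (hx : IsJordanBasis ρ σ x)
    (hσ : ∀ g : G, g ∈ Subgroup.zpowers σ) (j : Fin l) :
    (splitLast hn x j (norm ρ (lastVariable hn x j))).Monic := by
  rw [coe_norm, map_prod]
  refine Polynomial.monic_prod_of_monic _ _ fun g _ => ?_
  rw [act_lastVariable, map_add, splitLast_lastVariable, hx.splitLast_lastShift hn hσ]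
  exact Polynomial.monic_X_add_C _

theorem IsJordanBasis.splitLast_norm_of_ne (hx : IsJordanBasis ρ σ x)
    (hσ : ∀ g : G, g ∈ Subgroup.zpowers σ) {i j : Fin l} (hij : i ≠ j) :
    splitLast hn x j (norm ρ (lastVariable hn x i)) =
      Polynomial.C (norm ρ (lastVariable hn x i) : PolyRing K V) := by
  rw [coe_norm, map_prod, map_prod]
  refine Finset.prod_congr rfl fun g _ => ?_
  rw [act_lastVariable, map_add, hx.splitLast_lastShift hn hσ, lastVariable_eq,
    splitLast_basis hn x fun h => hij (congrArg Sigma.fst h), map_add]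

/-- Only the last variable of block `j` involves `Y` after the action: it is translated by a form
free of `Y`, and no other variable acquires it. -/
theorem IsJordanBasis.splitLast_act (hx : IsJordanBasis ρ σ x)
    (hσ : ∀ g : G, g ∈ Subgroup.zpowers σ) (j : Fin l) (g : G) (f : PolyRing K V) :
    splitLast hn x j (act ρ g f) =
      ((splitLast hn x j f).map (act ρ g : PolyRing K V →+* PolyRing K V)).comp
        (Polynomial.X + Polynomial.C (lastShift hn ρ x j g)) := by
  let Ψ : Polynomial (PolyRing K V) →ₐ[K] Polynomial (PolyRing K V) :=
    ((Polynomial.taylorAlgHom (lastShift hn ρ x j g)).restrictScalars K).comp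
      (Polynomial.mapAlgHom (act ρ g))
  have hΨ : ∀ F, Ψ F = (F.map (act ρ g : PolyRing K V →+* PolyRing K V)).comp
      (Polynomial.X + Polynomial.C (lastShift hn ρ x j g)) := fun F => rfl
  have : (splitLast hn x j).comp (act ρ g) = Ψ.comp (splitLast hn x j) := by
    refine polyRing_algHom_ext fun v => ?_
    have : ((splitLast hn x j).comp (act ρ g)).toLinearMap ∘ₗ linearForm K V =
        (Ψ.comp (splitLast hn x j)).toLinearMap ∘ₗ linearForm K V := x.ext fun s => by
      change splitLast hn x j (act ρ g (linearForm K V (x s))) =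
        Ψ (splitLast hn x j (linearForm K V (x s)))
      rw [hΨ]
      by_cases hs : s = lastIndex hn j
      · subst hs
        rw [← lastVariable_eq, act_lastVariable, map_add, splitLast_lastVariable,
          hx.splitLast_lastShift hn hσ]
        simp
      · rw [splitLast_basis hn x hs, Polynomial.map_C, Polynomial.C_comp]
        have h1 := splitLast_of_mem_lowerSpan hn x (j := j) (hx.dual_sub_mem_lowerSpan hσ g s)
        rw [map_sub, map_sub, map_sub, splitLast_basis hn x hs, sub_left_inj] at h1
        rw [act_linearForm, h1]
        simp
    exact LinearMap.congr_fun this v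
  rw [← hΨ]
  exact DFunLike.congr_fun this f

/-- The quotient of the division by the norm `N(y)` with respect to the last variable `y` of the
`j`-th block. -/
noncomputable def IsJordanBasis.quotLast (hx : IsJordanBasis ρ σ x)
    (hσ : ∀ g : G, g ∈ Subgroup.zpowers σ) (j : Fin l) : PolyRing K V →+ PolyRing K V :=
  AddMonoidHom.mk' (fun f => (splitLast hn x j f /ₘ
    splitLast hn x j (norm ρ (lastVariable hn x j))).eval (lastVariable hn x j)) fun f g => by
    rw [map_add, add_divByMonic (hx.monic_splitLast_norm hn hσ j), Polynomial.eval_add]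

variable (hx : IsJordanBasis ρ σ x) (hσ : ∀ g : G, g ∈ Subgroup.zpowers σ)

theorem IsJordanBasis.quotLast_apply (j : Fin l) (f : PolyRing K V) :
    hx.quotLast hn hσ j f = (splitLast hn x j f /ₘ
      splitLast hn x j (norm ρ (lastVariable hn x j))).eval (lastVariable hn x j) :=
  rfl

theorem IsJordanBasis.quotLast_norm_mul (j : Fin l) (f : PolyRing K V) :
    hx.quotLast hn hσ j (norm ρ (lastVariable hn x j) * f) = f := by
  rw [quotLast_apply, map_mul, Polynomial.mul_divByMonic_cancel_left _
    (hx.monic_splitLast_norm hn hσ j), eval_splitLast]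

theorem IsJordanBasis.quotLast_mul {j : Fin l} {a : PolyRing K V}
    (ha : splitLast hn x j a = Polynomial.C a) (f : PolyRing K V) :
    hx.quotLast hn hσ j (a * f) = a * hx.quotLast hn hσ j f := by
  rw [quotLast_apply, quotLast_apply, map_mul, ha,
    C_mul_divByMonic (hx.monic_splitLast_norm hn hσ j), Polynomial.eval_mul, Polynomial.eval_C]

/-- The norm is invariant, so `g` carries division by it to division by the same polynomial;
evaluating `Y` plus the shift at `y_j` gives `g y_j`. -/
theorem IsJordanBasis.quotLast_act (j : Fin l) (g : G) (f : PolyRing K V) :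
    hx.quotLast hn hσ j (act ρ g f) = act ρ g (hx.quotLast hn hσ j f) := by
  have hN := hx.splitLast_act hn hσ j g (norm ρ (lastVariable hn x j) : PolyRing K V)
  rw [(norm ρ (lastVariable hn x j)).2 g] at hN
  rw [quotLast_apply, hN, hx.splitLast_act hn hσ, ← map_comp_divByMonic
    (hx.monic_splitLast_norm hn hσ j), Polynomial.eval_comp, Polynomial.eval_add,
    Polynomial.eval_X, Polynomial.eval_C, ← act_lastVariable, quotLast_apply]
  exact Polynomial.eval_map_apply _ _

/-- The division operator `quotLast` on invariants. -/
noncomputable def IsJordanBasis.quotInvariant (j : Fin l) :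
    invariantRing ρ →+ invariantRing ρ where
  toFun a := ⟨hx.quotLast hn hσ j a, fun g => by rw [← hx.quotLast_act hn hσ, a.2 g]⟩
  map_zero' := Subtype.ext (map_zero _)
  map_add' a b := Subtype.ext (map_add _ _ _)

theorem IsJordanBasis.quotInvariant_norm_mul (j : Fin l) (a : invariantRing ρ) :
    hx.quotInvariant hn hσ j (norm ρ (lastVariable hn x j) * a) = a :=
  Subtype.ext (hx.quotLast_norm_mul hn hσ j a)

theorem IsJordanBasis.quotInvariant_mul {j : Fin l} {a : invariantRing ρ}
    (ha : splitLast hn x j a = Polynomial.C (a : PolyRing K V)) (b : invariantRing ρ) :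
    hx.quotInvariant hn hσ j (a * b) = a * hx.quotInvariant hn hσ j b :=
  Subtype.ext (hx.quotLast_mul hn hσ ha b)

/-- By equivariance, the quotient of a transfer is the transfer of the quotient. -/
theorem IsJordanBasis.quotInvariant_mem_transferIdeal (j : Fin l) :
    ∀ a ∈ transferIdeal ρ, hx.quotInvariant hn hσ j a ∈ transferIdeal ρ := by
  rintro _ ⟨f, rfl⟩
  refine ⟨hx.quotLast hn hσ j f, Subtype.ext ?_⟩
  change _ = hx.quotLast hn hσ j (transfer ρ f : PolyRing K V)
  simp only [coe_transfer, map_sum, hx.quotLast_act]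

end Division
theorem ringKrullDim_eq_card_of_algebraicIndependent {K R ι : Type*} [Field K] [CommRing R]
    [Algebra K R] [Finite ι] {a : ι → R} (ha : AlgebraicIndependent K a)
    [Algebra.IsIntegral (Algebra.adjoin K (Set.range a)) R] : ringKrullDim R = Nat.card ι := by
  rw [ringKrullDim_eq_of_isIntegral (R := Algebra.adjoin K (Set.range a)) Subtype.val_injective,
    ← ringKrullDim_eq_of_ringEquiv ha.aevalEquiv.toRingEquiv]
  simp

/-! ### Comparing invariants modulo the transfer ideal with functions on `V^G` -/

section FixedPoints

variable {K G V : Type*} [Field K] [Group G] [AddCommGroup V] [Module K V]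
  {ρ : Representation K G V} {σ : G} {l : ℕ} {n : Fin l → ℕ} (hn : ∀ j, 1 < n j)
  {x : Module.Basis (Σ j : Fin l, Fin (n j)) K (Module.Dual K V)}

theorem constantCoeff_restrictFixed_linearForm (v : Module.Dual K V) :
    MvPolynomial.constantCoeff (restrictFixed x (linearForm K V v)) = 0 := by
  have hv : v ∈ Submodule.span K (Set.range x) := x.span_eq ▸ Submodule.mem_top
  induction hv using Submodule.span_induction with
  | mem v hv =>
    obtain ⟨s, rfl⟩ := hv
    rw [restrictFixed_linearForm]
    split_ifs <;> simp
  | zero => simp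
  | add a b _ _ ha hb => rw [map_add, map_add, map_add, ha, hb, add_zero]
  | smul c a _ ha =>
    rw [map_smul, map_smul, MvPolynomial.smul_eq_C_mul, map_mul, ha, mul_zero]

theorem constantCoeff_restrictFixed_of_mem_polyGrading {d : ℕ} (hd : 0 < d) {f : PolyRing K V}
    (hf : f ∈ polyGrading K V d) :
    MvPolynomial.constantCoeff (restrictFixed x f) = 0 := by
  obtain ⟨e, rfl⟩ := Nat.exists_eq_succ_of_ne_zero hd.ne'
  rw [polyGrading, pow_succ] at hf
  induction hf using Submodule.mul_induction_on' with
  | mem_mul_mem a _ b hb =>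
    obtain ⟨v, rfl⟩ := hb
    rw [map_mul, map_mul, constantCoeff_restrictFixed_linearForm, mul_zero]
  | add a _ b _ ha hb => rw [map_add, map_add, ha, hb, add_zero]

variable [Fintype G]

theorem norm_mem_invariantGrading (v : Module.Dual K V) :
    norm ρ (linearForm K V v) ∈ invariantGrading ρ (Fintype.card G) := by
  change (∏ g : G, act ρ g (linearForm K V v)) ∈ LinearMap.range (linearForm K V) ^ _
  rw [Fintype.card]
  induction (Finset.univ : Finset G) using Finset.cons_induction with
  | empty => simp
  | cons g t hg ih =>
    rw [Finset.prod_cons, Finset.card_cons, pow_succ']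
    exact Submodule.mul_mem_mul ⟨_, (act_linearForm ρ g v).symm⟩ ih

variable (hx : IsJordanBasis ρ σ x) (hσ : ∀ g : G, g ∈ Subgroup.zpowers σ)
include hx hσ

theorem IsJordanBasis.restrictFixed_transferIdeal (hG : (Fintype.card G : K) = 0)
    {a : invariantRing ρ} (ha : a ∈ transferIdeal ρ) :
    restrictFixed x (a : PolyRing K V) = 0 := by
  obtain ⟨f, rfl⟩ := ha
  rw [coe_transfer, map_sum]
  simp only [hx.restrictFixed_act hσ, Finset.sum_const, Finset.card_univ]
  rw [← Nat.cast_smul_eq_nsmul K, hG, zero_smul]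

theorem IsJordanBasis.restrictFixed_norm (j : Fin l) :
    restrictFixed x (norm ρ (lastVariable hn x j) : PolyRing K V) =
      MvPolynomial.X j ^ Fintype.card G := by
  rw [coe_norm, map_prod]
  simp only [hx.restrictFixed_act hσ, restrictFixed_lastVariable, Finset.prod_const,
    Finset.card_univ]

-- Each variable that is not last is `(σ - 1)` of the next one, so it vanishes modulo the radical.
-- The quotient map of `K[V]` thus factors through restriction, with `τ` as section.
include hn in
omit hσ in
theorem IsJordanBasis.mem_radical_map_of_restrictFixed_eq_zero (hG : (Fintype.card G).Prime)
    {f : PolyRing K V} (hf : restrictFixed x f = 0) :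
    f ∈ ((transferIdeal ρ).map (algebraMap (invariantRing ρ) (PolyRing K V))).radical := by
  set J := ((transferIdeal ρ).map (algebraMap (invariantRing ρ) (PolyRing K V))).radical
  let τ : MvPolynomial (Fin l) K →ₐ[K] PolyRing K V := MvPolynomial.aeval (lastVariable hn x)
  have key : ((Ideal.Quotient.mkₐ K J).comp τ).comp (restrictFixed x) = Ideal.Quotient.mkₐ K J := by
    refine polyRing_algHom_ext fun v => ?_
    have : (((Ideal.Quotient.mkₐ K J).comp τ).comp (restrictFixed x)).toLinearMap ∘ₗ
        linearForm K V = (Ideal.Quotient.mkₐ K J).toLinearMap ∘ₗ linearForm K V := x.ext fun s => by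
      change Ideal.Quotient.mkₐ K J (τ (restrictFixed x (linearForm K V (x s)))) =
        Ideal.Quotient.mkₐ K J (linearForm K V (x s))
      obtain ⟨j, i⟩ := s
      rw [restrictFixed_linearForm]
      split_ifs with h
      · have : (⟨j, i⟩ : Σ j : Fin l, Fin (n j)) = lastIndex hn j := by
          simp only at h
          have hi : (i : ℕ) = n j - 1 := by omega
          exact congrArg (Sigma.mk j) (Fin.ext hi)
        rw [MvPolynomial.aeval_X, this, lastVariable_eq]
        rfl
      · have hi : (i : ℕ) + 1 < n j := by
          have := i.2
          simp only at h
          omega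
        rw [map_zero, map_zero, eq_comm, Ideal.Quotient.mkₐ_eq_mk, Ideal.Quotient.eq_zero_iff_mem]
        have := act_sub_mem_radical_map_transferIdeal ρ hG σ (linearForm K V (x ⟨j, ⟨i + 1, hi⟩⟩))
        rwa [act_linearForm, hx.2 j i ⟨i + 1, hi⟩ rfl, map_add, add_sub_cancel_left] at this
    exact LinearMap.congr_fun this v
  have := DFunLike.congr_fun key f
  rw [AlgHom.comp_apply, hf, map_zero] at this
  exact Ideal.Quotient.eq_zero_iff_mem.mp this.symm

include hn in
omit hσ in
theorem IsJordanBasis.mem_radical_transferIdeal (hG : (Fintype.card G).Prime)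
    {f : invariantRing ρ} (hf : restrictFixed x (f : PolyRing K V) = 0) :
    f ∈ (transferIdeal ρ).radical :=
  mem_radical_of_coe_mem_radical_map ρ (hx.mem_radical_map_of_restrictFixed_eq_zero hn hG hf)

omit hx hσ

/-- The polynomials in the norms of the last variables. -/
noncomputable def normPolynomial (ρ : Representation K G V)
    (x : Module.Basis (Σ j : Fin l, Fin (n j)) K (Module.Dual K V)) :
    MvPolynomial (Fin l) K →ₐ[K] invariantRing ρ :=
  MvPolynomial.aeval fun j => norm ρ (lastVariable hn x j)

include hx hσ

theorem IsJordanBasis.restrictFixed_normPolynomial (F : MvPolynomial (Fin l) K) :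
    restrictFixed x (normPolynomial hn ρ x F : PolyRing K V) =
      MvPolynomial.expand (Fintype.card G) F := by
  have : ((restrictFixed x).comp (invariantRing ρ).val).comp (normPolynomial hn ρ x) =
      MvPolynomial.expand (Fintype.card G) := by
    refine MvPolynomial.algHom_ext fun j => ?_
    rw [AlgHom.comp_apply, normPolynomial, MvPolynomial.aeval_X, MvPolynomial.expand_X]
    exact hx.restrictFixed_norm hn hσ j
  exact DFunLike.congr_fun this F

/-- If `F` is the restriction of `f` with Frobenius applied to its coefficients, then `F(y_1^p, …,
y_l^p)` is the `p`-th power of that restriction. As `N_j` restricts to `y_j^p`, the difference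
restricts to zero. -/
theorem IsJordanBasis.pow_sub_normPolynomial_mem_radical {p : ℕ} [Fact p.Prime] [CharP K p]
    (hG : Fintype.card G = p) (f : invariantRing ρ) :
    f ^ p - normPolynomial hn ρ x ((restrictFixed x (f : PolyRing K V)).map (frobenius K p)) ∈
      (transferIdeal ρ).radical := by
  have hp : p.Prime := Fact.out
  refine hx.mem_radical_transferIdeal hn (hG ▸ hp) ?_
  have h1 := hx.restrictFixed_normPolynomial hn hσ
    ((restrictFixed x (f : PolyRing K V)).map (frobenius K p))
  rw [hG, ← MvPolynomial.map_expand, MvPolynomial.map_frobenius_expand] at h1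
  change restrictFixed x ((f : PolyRing K V) ^ p - _) = 0
  rw [map_sub, h1, map_pow, sub_self]

omit hx hσ in
theorem normPolynomial_mem_span {F : MvPolynomial (Fin l) K}
    (hF : MvPolynomial.constantCoeff F = 0) :
    normPolynomial hn ρ x F ∈
      Ideal.span (Set.range fun j => norm ρ (lastVariable hn x j)) := by
  set L := Ideal.span (Set.range fun j => norm ρ (lastVariable hn x j)) with hL
  have : (Ideal.Quotient.mkₐ K L).comp (normPolynomial hn ρ x) =
      (Algebra.ofId K _).comp (MvPolynomial.aeval (fun _ => (0 : K))) := by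
    refine MvPolynomial.algHom_ext fun j => ?_
    rw [AlgHom.comp_apply, AlgHom.comp_apply, normPolynomial, MvPolynomial.aeval_X,
      MvPolynomial.aeval_X, map_zero, Ideal.Quotient.mkₐ_eq_mk, Ideal.Quotient.eq_zero_iff_mem]
    exact Ideal.subset_span ⟨j, rfl⟩
  have := DFunLike.congr_fun this F
  rw [AlgHom.comp_apply, AlgHom.comp_apply, MvPolynomial.aeval_zero', hF] at this
  rw [← Ideal.Quotient.eq_zero_iff_mem]
  simpa using this

/-- The restriction of a positive-degree invariant has no constant term, so its `p`-th power is,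
modulo the radical of the transfer ideal, a polynomial in the norms without constant term. -/
theorem IsJordanBasis.irrelevantIdeal_le_radical {p : ℕ} [Fact p.Prime] [CharP K p]
    (hG : Fintype.card G = p) :
    irrelevantIdeal (invariantGrading ρ) ≤
      (transferIdeal ρ ⊔ Ideal.span (Set.range fun j => norm ρ (lastVariable hn x j))).radical := by
  refine Ideal.span_le.mpr ?_
  rintro f ⟨d, hd, hf⟩
  have hp : p.Prime := Fact.out
  have h0 : MvPolynomial.constantCoeff (restrictFixed x (f : PolyRing K V)) = 0 :=
    constantCoeff_restrictFixed_of_mem_polyGrading hd hf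
  have h1 : normPolynomial hn ρ x ((restrictFixed x (f : PolyRing K V)).map (frobenius K p)) ∈
      Ideal.span (Set.range fun j => norm ρ (lastVariable hn x j)) :=
    normPolynomial_mem_span hn (by rw [MvPolynomial.constantCoeff_map, h0, map_zero])
  have h2 := add_mem
    (Ideal.radical_mono le_sup_left (hx.pow_sub_normPolynomial_mem_radical hn hσ hG f))
    (Ideal.le_radical (le_sup_right (a := transferIdeal ρ) h1))
  rw [sub_add_cancel] at h2
  exact Ideal.mem_radical_of_pow_mem h2

theorem IsJordanBasis.sup_span_norm_ne_top (hG : (Fintype.card G : K) = 0) :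
    transferIdeal ρ ⊔ Ideal.span (Set.range fun j => norm ρ (lastVariable hn x j)) ≠ ⊤ := by
  -- `ε` is evaluation at the origin, where transfers and norms of last variables vanish.
  let ε : invariantRing ρ →+* K := MvPolynomial.constantCoeff.comp
    ((restrictFixed x : PolyRing K V →+* MvPolynomial (Fin l) K).comp
      ((invariantRing ρ).val : invariantRing ρ →+* PolyRing K V))
  have hle : transferIdeal ρ ⊔ Ideal.span (Set.range fun j => norm ρ (lastVariable hn x j)) ≤
      RingHom.ker ε := by
    refine sup_le (fun a ha => ?_) (Ideal.span_le.mpr ?_)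
    · change MvPolynomial.constantCoeff (restrictFixed x (a : PolyRing K V)) = 0
      rw [hx.restrictFixed_transferIdeal hσ hG ha, map_zero]
    · rintro _ ⟨j, rfl⟩
      change MvPolynomial.constantCoeff
        (restrictFixed x (norm ρ (lastVariable hn x j) : PolyRing K V)) = 0
      rw [hx.restrictFixed_norm hn hσ, map_pow, MvPolynomial.constantCoeff_X,
        zero_pow Fintype.card_ne_zero]
  exact fun htop => RingHom.ker_ne_top ε (top_le_iff.mp (htop ▸ hle))

/-- A relation modulo the transfer ideal restricts to a relation among the independent elements `y_j
^ |G|`. -/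
theorem IsJordanBasis.algebraicIndependent_norm (hG : (Fintype.card G : K) = 0) :
    AlgebraicIndependent K fun j => Ideal.Quotient.mk (transferIdeal ρ)
      (norm ρ (lastVariable hn x j)) := by
  have heq : MvPolynomial.aeval (fun j => Ideal.Quotient.mk (transferIdeal ρ)
      (norm ρ (lastVariable hn x j))) =
      (Ideal.Quotient.mkₐ K (transferIdeal ρ)).comp (normPolynomial hn ρ x) := by
    refine MvPolynomial.algHom_ext fun j => ?_
    rw [AlgHom.comp_apply, normPolynomial, MvPolynomial.aeval_X, MvPolynomial.aeval_X]
    rfl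
  rw [AlgebraicIndependent, heq, injective_iff_map_eq_zero]
  intro F hF
  have h1 := hx.restrictFixed_transferIdeal hσ hG (Ideal.Quotient.eq_zero_iff_mem.mp hF)
  replace h1 := (hx.restrictFixed_normPolynomial hn hσ F).symm.trans h1
  exact (MvPolynomial.expand_eq_zero Fintype.card_pos).mp h1

/-- Modulo transfers, `f ^ p` is a nilpotent element plus a polynomial in the norms, both integral.
-/
theorem IsJordanBasis.isIntegral_quotient {p : ℕ} [Fact p.Prime] [CharP K p]
    (hG : Fintype.card G = p) :
    Algebra.IsIntegral (Algebra.adjoin K (Set.range fun j => Ideal.Quotient.mk (transferIdeal ρ)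
      (norm ρ (lastVariable hn x j)))) (invariantRing ρ ⧸ transferIdeal ρ) := by
  have hp : p.Prime := Fact.out
  refine ⟨fun c => ?_⟩
  obtain ⟨f, rfl⟩ := Ideal.Quotient.mk_surjective c
  set B := Algebra.adjoin K (Set.range fun j => Ideal.Quotient.mk (transferIdeal ρ)
      (norm ρ (lastVariable hn x j))) with hB
  have hF : ∀ F, Ideal.Quotient.mk (transferIdeal ρ) (normPolynomial hn ρ x F) ∈ B := by
    intro F
    rw [hB, Algebra.adjoin_range_eq_range_aeval]
    refine ⟨F, ?_⟩
    have : MvPolynomial.aeval (fun j => Ideal.Quotient.mk (transferIdeal ρ)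
        (norm ρ (lastVariable hn x j))) =
        (Ideal.Quotient.mkₐ K (transferIdeal ρ)).comp (normPolynomial hn ρ x) := by
      refine MvPolynomial.algHom_ext fun j => ?_
      rw [AlgHom.comp_apply, normPolynomial, MvPolynomial.aeval_X, MvPolynomial.aeval_X]
      rfl
    exact DFunLike.congr_fun this F
  obtain ⟨k, hk⟩ := hx.pow_sub_normPolynomial_mem_radical hn hσ hG f
  set F := (restrictFixed x (f : PolyRing K V)).map (frobenius K p)
  refine IsIntegral.of_pow hp.pos ?_
  have h1 : IsIntegral B
      (Ideal.Quotient.mk (transferIdeal ρ) (f ^ p - normPolynomial hn ρ x F)) := by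
    refine ⟨Polynomial.X ^ k, Polynomial.monic_X_pow k, ?_⟩
    rw [Polynomial.eval₂_pow, Polynomial.eval₂_X, ← map_pow]
    exact Ideal.Quotient.eq_zero_iff_mem.mpr hk
  have h2 : IsIntegral B (Ideal.Quotient.mk (transferIdeal ρ) (normPolynomial hn ρ x F)) :=
    isIntegral_algebraMap (R := B) (x := ⟨_, hF F⟩)
  have h3 := h1.add h2
  rwa [← map_add, sub_add_cancel, map_pow] at h3

include hn in
theorem IsJordanBasis.ringKrullDim_quotient {p : ℕ} [Fact p.Prime] [CharP K p]
    (hG : Fintype.card G = p) :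
    ringKrullDim (invariantRing ρ ⧸ transferIdeal ρ) = l := by
  have := hx.isIntegral_quotient hn hσ hG
  have hcard : (Fintype.card G : K) = 0 := by rw [hG, CharP.cast_eq_zero]
  rw [ringKrullDim_eq_card_of_algebraicIndependent (hx.algebraicIndependent_norm hn hσ hcard),
    Nat.card_eq_fintype_card, Fintype.card_fin]

end FixedPoints
-- Computing depth from a socle element
section Depth

/-- A homogeneous regular sequence computes the depth as soon as the quotient by it has a nonzero
element killed by the irrelevant ideal. -/
theorem depth_eq_length {K : Type*} {R M : Type u} [CommRing K] [CommRing R] [Algebra K R]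
    [IsNoetherianRing R] [AddCommGroup M] [Module R M] [Module.Finite R M]
    {𝒜 : ℕ → Submodule K R} {as : List R}
    (has : IsHomogeneousRegularSeq 𝒜 (irrelevantIdeal 𝒜) M as)
    {u : M} (hu : u ∉ (Ideal.ofList as • ⊤ : Submodule R M))
    (hJu : ∀ c ∈ irrelevantIdeal 𝒜, c • u ∈ (Ideal.ofList as • ⊤ : Submodule R M)) :
    depth 𝒜 M = as.length := by
  refine le_antisymm (iSup₂_le fun bs hbs => ?_) (le_iSup₂_of_le as has le_rfl)
  exact Nat.cast_le.mpr (length_le_of_isWeaklyRegular (irrelevantIdeal 𝒜) has.2 hbs.2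
    (fun b hb => (hbs.1 b hb).1) hu hJu)

theorem moduleDim_self (R : Type*) [CommRing R] : moduleDim R R = ringKrullDim R := by
  have h : Module.annihilator R R = ⊥ := Module.annihilator_eq_bot.mpr inferInstance
  rw [moduleDim, h]
  exact ringKrullDim_eq_of_ringEquiv (RingEquiv.quotientBot R)

theorem irrelevantIdeal_quotientGrading_le {K R : Type*} [CommRing K] [CommRing R] [Algebra K R]
    (𝒜 : ℕ → Submodule K R) (I : Ideal R) :
    irrelevantIdeal (quotientGrading 𝒜 I) ≤ (irrelevantIdeal 𝒜).map (Ideal.Quotient.mk I) := by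
  refine Ideal.span_le.mpr ?_
  rintro _ ⟨d, hd, a, ha, rfl⟩
  exact Ideal.mem_map_of_mem _ (Ideal.subset_span ⟨d, hd, ha⟩)

theorem exists_quotient_addMonoidHom {A : Type*} [CommRing A] (I : Ideal A) (Q : A →+ A)
    (hQ : ∀ a ∈ I, Q a ∈ I) :
    ∃ Q' : A ⧸ I →+ A ⧸ I, ∀ a, Q' (Ideal.Quotient.mk I a) = Ideal.Quotient.mk I (Q a) :=
  ⟨QuotientAddGroup.map I.toAddSubgroup I.toAddSubgroup Q hQ, fun _ => rfl⟩

theorem finite_adjoin_of_isIntegral {K R : Type*} [CommRing K] [CommRing R] [Algebra K R]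
    [Algebra.FiniteType K R] (s : Set R) [Algebra.IsIntegral (Algebra.adjoin K s) R] :
    Module.Finite (Algebra.adjoin K s) R := by
  have : Algebra.FiniteType (Algebra.adjoin K s) R :=
    Algebra.FiniteType.of_restrictScalars_finiteType K _ _
  exact Algebra.IsIntegral.finite

end Depth

/-! ### The three assertions for the transfer ideal -/

section Invariants

variable {K G V : Type*} [Field K] [Group G] [Fintype G] [AddCommGroup V] [Module K V]
  [FiniteDimensional K V]
  {ρ : Representation K G V} {σ : G} {l : ℕ} {n : Fin l → ℕ} (hn : ∀ j, 1 < n j)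
  {x : Module.Basis (Σ j : Fin l, Fin (n j)) K (Module.Dual K V)}
  {p : ℕ} [Fact p.Prime] [CharP K p] (hG : Fintype.card G = p)
  (hx : IsJordanBasis ρ σ x) (hσ : ∀ g : G, g ∈ Subgroup.zpowers σ)
include hn hG hx hσ

theorem IsJordanBasis.exists_socle :
    ∃ s ∉ transferIdeal ρ ⊔ Ideal.span (Set.range fun j => norm ρ (lastVariable hn x j)),
      ∀ c ∈ irrelevantIdeal (invariantGrading ρ), c * s ∈
        transferIdeal ρ ⊔ Ideal.span (Set.range fun j => norm ρ (lastVariable hn x j)) := by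
  have := isNoetherianRing_invariantRing ρ
  exact exists_notMem_forall_mul_mem
    (hx.sup_span_norm_ne_top hn hσ (by rw [hG, CharP.cast_eq_zero]))
    (hx.irrelevantIdeal_le_radical hn hσ hG)

theorem IsJordanBasis.depth_quotient :
    depth (quotientGrading (invariantGrading ρ) (transferIdeal ρ))
      (invariantRing ρ ⧸ transferIdeal ρ) = l := by
  have hp : p.Prime := Fact.out
  have := isNoetherianRing_invariantRing ρ
  set I := transferIdeal ρ
  set N : Fin l → invariantRing ρ := fun j => norm ρ (lastVariable hn x j) with hN
  choose Q hQ using fun j => exists_quotient_addMonoidHom I (hx.quotInvariant hn hσ j)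
    (hx.quotInvariant_mem_transferIdeal hn hσ j)
  have hreg : RingTheory.Sequence.IsWeaklyRegular (invariantRing ρ ⧸ I)
      (List.ofFn fun j => Ideal.Quotient.mk I (N j)) := by
    refine isWeaklyRegular_ofFn_of_leftInverse _ Q (fun j m => ?_) fun i j hij m => ?_
    · obtain ⟨a, rfl⟩ := Ideal.Quotient.mk_surjective m
      rw [smul_eq_mul, ← map_mul, hQ, hx.quotInvariant_norm_mul hn hσ]
    · obtain ⟨a, rfl⟩ := Ideal.Quotient.mk_surjective m
      rw [smul_eq_mul, smul_eq_mul, ← map_mul, hQ, hQ, ← map_mul,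
        hx.quotInvariant_mul hn hσ (hx.splitLast_norm_of_ne hn hσ hij)]
  have hspan : (Ideal.ofList (List.ofFn fun j => Ideal.Quotient.mk I (N j)) • ⊤ :
      Submodule (invariantRing ρ ⧸ I) (invariantRing ρ ⧸ I)) =
      (Ideal.span (Set.range N)).map (Ideal.Quotient.mk I) := by
    rw [smul_eq_mul, Ideal.mul_top, Ideal.map_span, ← Set.range_comp, Ideal.ofList]
    congr 1
    ext c
    simp
  obtain ⟨s, hs, hJs⟩ := hx.exists_socle hn hG hσ
  have hdepth := depth_eq_length (𝒜 := quotientGrading (invariantGrading ρ) I)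
    (M := invariantRing ρ ⧸ I) (as := List.ofFn fun j => Ideal.Quotient.mk I (N j))
    (u := Ideal.Quotient.mk I s) ⟨fun c hc => ?_, hreg⟩ ?_ ?_
  · rw [hdepth, List.length_ofFn]
  · obtain ⟨j, rfl⟩ := (List.mem_ofFn' _ _).mp hc
    have hmem : Ideal.Quotient.mk I (N j) ∈
        quotientGrading (invariantGrading ρ) I (Fintype.card G) :=
      ⟨N j, norm_mem_invariantGrading _, rfl⟩
    exact ⟨Ideal.subset_span ⟨_, Fintype.card_pos, hmem⟩, _, hmem⟩
  · rw [hspan, Ideal.mem_quotient_iff_mem_sup, sup_comm]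
    exact hs
  · intro c hc
    obtain ⟨b, hb, rfl⟩ := (Ideal.mem_map_iff_of_surjective _ Ideal.Quotient.mk_surjective).mp
      (irrelevantIdeal_quotientGrading_le _ _ hc)
    rw [hspan, smul_eq_mul, ← map_mul, Ideal.mem_quotient_iff_mem_sup, sup_comm]
    exact hJs b hb

theorem IsJordanBasis.isCohenMacaulay_quotient :
    IsCohenMacaulay (quotientGrading (invariantGrading ρ) (transferIdeal ρ))
      (invariantRing ρ ⧸ transferIdeal ρ) := by
  refine ⟨inferInstance, ?_, ?_⟩
  · refine Ideal.Quotient.nontrivial_iff.mpr fun h => ?_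
    exact hx.sup_span_norm_ne_top hn hσ (by rw [hG, CharP.cast_eq_zero]) (by rw [h, top_sup_eq])
  · rw [hx.depth_quotient hn hG hσ, moduleDim_self, hx.ringKrullDim_quotient hn hσ hG]
    rfl

theorem IsJordanBasis.isHsop_norm :
    IsHsop (quotientGrading (invariantGrading ρ) (transferIdeal ρ))
      fun j => Ideal.Quotient.mk (transferIdeal ρ) (norm ρ (lastVariable hn x j)) := by
  refine ⟨fun j => ⟨_, _, norm_mem_invariantGrading _, rfl⟩,
    hx.algebraicIndependent_norm hn hσ (by rw [hG, CharP.cast_eq_zero]), ?_⟩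
  have := hx.isIntegral_quotient hn hσ hG
  have := finiteType_invariantRing ρ
  have : Algebra.FiniteType K (invariantRing ρ ⧸ transferIdeal ρ) :=
    Algebra.FiniteType.of_surjective (Ideal.Quotient.mkₐ K _) (Ideal.Quotient.mkₐ_surjective K _)
  exact finite_adjoin_of_isIntegral _

omit [FiniteDimensional K V] hG in
theorem IsJordanBasis.act_firstVariable (j : Fin l) (g : G) :
    act ρ g (linearForm K V (x (firstIndex hn j))) = linearForm K V (x (firstIndex hn j)) := by
  have h := hx.dual_sub_mem_lowerSpan hσ g (firstIndex hn j)
  have h0 : lowerSpan x (firstIndex hn j) = ⊥ := by simp [lowerSpan, firstIndex]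
  rw [h0, Submodule.mem_bot, sub_eq_zero] at h
  rw [act_linearForm, h]

theorem IsJordanBasis.depth_transferIdeal (hl : 1 ≤ l) :
    depth (invariantGrading ρ) (transferIdeal ρ) = (l : ℕ∞) + 1 := by
  have hp : p.Prime := Fact.out
  have := isNoetherianRing_invariantRing ρ
  set I := transferIdeal ρ
  set N : Fin l → invariantRing ρ := fun j => norm ρ (lastVariable hn x j) with hN
  -- The first variable of any block would do; one exists because `1 ≤ l`. As `1 < n j`, it is not a
  -- last variable, so it commutes with every `Q j`.
  let y : invariantRing ρ := ⟨linearForm K V (x (firstIndex hn ⟨0, hl⟩)),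
    hx.act_firstVariable hn hσ ⟨0, hl⟩⟩
  have hy0 : y ≠ 0 := fun h => linearForm_basis_ne_zero x _ (congrArg Subtype.val h)
  have hy1 : y ∈ invariantGrading ρ 1 := by
    change linearForm K V _ ∈ LinearMap.range (linearForm K V) ^ 1
    rw [pow_one]
    exact LinearMap.mem_range_self _ _
  have hyJ : y ∈ irrelevantIdeal (invariantGrading ρ) :=
    Ideal.subset_span ⟨1, one_pos, hy1⟩
  let Q : Fin l → invariantRing ρ →+ invariantRing ρ := hx.quotInvariant hn hσ
  have hQI : ∀ j, ∀ a ∈ I, Q j a ∈ I := hx.quotInvariant_mem_transferIdeal hn hσ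
  have hQ : ∀ j a, Q j (N j * a) = a := hx.quotInvariant_norm_mul hn hσ
  have hQN : ∀ i j, i ≠ j → ∀ a, Q j (N i * a) = N i * Q j a := fun i j hij =>
    hx.quotInvariant_mul hn hσ (hx.splitLast_norm_of_ne hn hσ hij)
  have hQy : ∀ j a, Q j (y * a) = y * Q j a := fun j =>
    hx.quotInvariant_mul hn hσ (splitLast_basis hn x fun h => by
      have h1 := congrArg (fun s : Σ j : Fin l, Fin (n j) => (s.2 : ℕ)) h
      have := hn j
      simp only [firstIndex, lastIndex] at h1
      omega)
  let QI : Fin l → I →+ I := fun j =>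
    { toFun := fun a => ⟨Q j a, hQI j a a.2⟩
      map_zero' := Subtype.ext (map_zero _)
      map_add' := fun a b => Subtype.ext (map_add _ _ _) }
  have hreg : RingTheory.Sequence.IsWeaklyRegular I (y :: List.ofFn N) := by
    refine isWeaklyRegular_cons_ofFn_of_leftInverse ?_ N QI (fun j m => Subtype.ext (hQ j m))
      (fun i j hij m => Subtype.ext (hQN i j hij m)) fun j m => Subtype.ext (hQy j m)
    exact fun a b hab => Subtype.ext (mul_left_cancel₀ hy0 (congrArg Subtype.val hab))
  obtain ⟨s, hs, hJs⟩ := hx.exists_socle hn hG hσ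
  obtain ⟨u, hu, hJu⟩ := exists_socle_ideal I (irrelevantIdeal (invariantGrading ρ)) hy0 N Q hQ
    hQN hQy hQI hyJ hs hJs
  have hdepth := depth_eq_length (𝒜 := invariantGrading ρ) (M := I) (as := y :: List.ofFn N)
    ⟨fun c hc => ?_, hreg⟩ hu hJu
  · rw [hdepth, List.length_cons, List.length_ofFn, Nat.cast_add, Nat.cast_one]
  · obtain rfl | hc := List.mem_cons.mp hc
    · exact ⟨hyJ, 1, hy1⟩
    · obtain ⟨j, rfl⟩ := (List.mem_ofFn' _ _).mp hc
      have hmem : N j ∈ invariantGrading ρ (Fintype.card G) := norm_mem_invariantGrading _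
      exact ⟨Ideal.subset_span ⟨_, Fintype.card_pos, hmem⟩, _, hmem⟩

end Invariants

end ModularTransfer

theorem mainTheorem1 {p : ℕ} (hp : p.Prime)
    {K : Type*} [Field K] [IsAlgClosed K] [CharP K p]
    {G : Type*} [Group G] [Fintype G] (hG : Fintype.card G = p)
    (σ : G) (hσ : ∀ g : G, g ∈ Subgroup.zpowers σ)
    {V : Type*} [AddCommGroup V] [Module K V] [FiniteDimensional K V]
    (ρ : Representation K G V)
    {l : ℕ} (hl : 1 ≤ l) {n : Fin l → ℕ} (hn : ∀ j, 1 < n j)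
    (x : Module.Basis (Σ j : Fin l, Fin (n j)) K (Module.Dual K V))
    (hx : ModularTransfer.IsJordanBasis ρ σ x) :
    ModularTransfer.IsCohenMacaulay
        (ModularTransfer.quotientGrading (ModularTransfer.invariantGrading ρ)
          (ModularTransfer.transferIdeal ρ))
        (ModularTransfer.invariantRing ρ ⧸ ModularTransfer.transferIdeal ρ) ∧
      ModularTransfer.IsHsop
        (ModularTransfer.quotientGrading (ModularTransfer.invariantGrading ρ)
          (ModularTransfer.transferIdeal ρ))
        (fun j : Fin l => Ideal.Quotient.mk (ModularTransfer.transferIdeal ρ)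
          (ModularTransfer.norm ρ (ModularTransfer.lastVariable hn x j))) ∧
      ModularTransfer.depth (ModularTransfer.invariantGrading ρ)
        (ModularTransfer.transferIdeal ρ) = (l : ℕ∞) + 1 := by
  have : Fact p.Prime := ⟨hp⟩
  exact ⟨hx.isCohenMacaulay_quotient hn hG hσ, hx.isHsop_norm hn hG hσ,
    hx.depth_transferIdeal hn hG hσ hl⟩
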